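/- Let $m,n\ge 1$ be integers with $n\le m$, let $N=m+n$, and write $x=(y,z)\in\mathbb R^m\times\mathbb R^n=\mathbb R^N$. For $\alpha>0$ let $E_\alpha=\{(y,z): |z|>\alpha|y|\}$ and $C_\alpha=\partial E_\alpha=\{(y,z): |z|=\alpha|y|\}$. For $0<s<1$, the cone $C_\alpha$ is called $s$-minimal if for every $p\in C_\alpha\setminus\{0\}$ the principal value $$\text{p.v.}\int_{\mathbb R^N}\frac{\chi_{E_\alpha}(x)-\chi_{\mathbb R^N\setminus E_\alpha}(x)}{|x-p|^{N+s}}\,dx=\lim_{\delta\to0^+}\int_{|x-p|\ge\delta}\frac{\chi_{E_\alpha}(x)-\chi_{\mathbb R^N\setminus E_\alpha}(x)}{|x-p|^{N+s}}\,dx$$ exists and equals $0$. Proposition. The function $t^{n-1}(1+t^2)^{-N/2}$ is integrable on $(0,\infty)$, and for all sufficiently small $s>0$ there is an $\alpha>0$ such that $C_\alpha$ is $s$-minimal. There is a number $\alpha_0>0$ such that for every choice of $\alpha_s>0$, defined for small $s>0$, with $C_{\alpha_s}$ $s$-minimal, the limit $\lim_{s\to0^+}\alpha_s$ exists and equals $\alpha_0$.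 Moreover $\alpha=\alpha_0$ is the unique solution $\alpha>0$ of $$\int_\alpha^\infty\frac{t^{n-1}}{(1+t^2)^{N/2}}\,dt-\int_0^\alpha\frac{t^{n-1}}{(1+t^2)^{N/2}}\,dt=0 .$$ -/

import Mathlib

open MeasureTheory Set Filter Topology

noncomputable section

/-- The integrand `(χ_E(x) - χ_{Eᶜ}(x)) / |x - p|^{N+s}` of the nonlocal mean curvature, in a
Euclidean space `V` of dimension `N`. -/
def curvatureIntegrand {V : Type*} [NormedAddCommGroup V] [InnerProductSpace ℝ V]
    (s : ℝ) (E : Set V) (p x : V) : ℝ :=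
  (E.indicator (fun _ => (1 : ℝ)) x - Eᶜ.indicator (fun _ => (1 : ℝ)) x) /
    ‖x - p‖ ^ ((Module.finrank ℝ V : ℝ) + s)

/-- The principal value integral
`H^s(p) = p.v. ∫ (χ_E(x) - χ_{Eᶜ}(x)) / |x - p|^{N+s} dx = lim_{δ → 0⁺} ∫_{|x - p| ≥ δ} …`
exists and equals `H`. -/
def HasNonlocalMeanCurvature {V : Type*} [NormedAddCommGroup V] [InnerProductSpace ℝ V]
    [FiniteDimensional ℝ V] [MeasurableSpace V] [BorelSpace V]
    (s : ℝ) (E : Set V) (p : V) (H : ℝ) : Prop :=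
  (∀ δ : ℝ, 0 < δ → IntegrableOn (curvatureIntegrand s E p) (Metric.ball p δ)ᶜ volume) ∧
    Tendsto (fun δ : ℝ => ∫ x in (Metric.ball p δ)ᶜ, curvatureIntegrand s E p x)
      (𝓝[>] 0) (𝓝 H)

/-- `ℝ^N = ℝ^m × ℝ^n`, `N = m + n`, with its Euclidean norm. -/
abbrev ProdSpace (m n : ℕ) : Type :=
  WithLp 2 (EuclideanSpace ℝ (Fin m) × EuclideanSpace ℝ (Fin n))

/-- The solid cone `E_α = {x = (y, z) : |z| > α |y|}`. -/
def solidCone (m n : ℕ) (α : ℝ) : Set (ProdSpace m n) :=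
  {x | α * ‖x.fst‖ < ‖x.snd‖}

/-- The cone `C_α = {x = (y, z) : |z| = α |y|}`, the boundary of `E_α` when `α > 0`. -/
def lawsonCone (m n : ℕ) (α : ℝ) : Set (ProdSpace m n) :=
  {x | ‖x.snd‖ = α * ‖x.fst‖}

/-- `C_α` with `α > 0` is an `s`-minimal cone: the nonlocal mean curvature of `C_α = ∂E_α` exists
and vanishes at every point other than the vertex (away from which `C_α` is a smooth
hypersurface). -/
def IsNonlocalMinimalCone (m n : ℕ) (s α : ℝ) : Prop :=
  0 < α ∧ ∀ p ∈ lawsonCone m n α, p ≠ 0 → HasNonlocalMeanCurvature s (solidCone m n α) p 0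

/-- The function `t ↦ t^{n-1} / (1 + t²)^{N/2}`, `N = m + n`, for `n ≥ 1`. -/
def coneDensity (m n : ℕ) (t : ℝ) : ℝ :=
  t ^ (n - 1) / (1 + t ^ 2) ^ (((m : ℝ) + (n : ℝ)) / 2)

end

/-! The sign of the curvature of `C_α` is carried by an absolutely convergent Gaussian integral that
depends on `α` through one parameter, monotonically, and still makes sense at `s = 0`.

Let `q(v) = |z|² - α²|y|²`. For `p ∈ C_α` one has `q(p) = 0`, so `p + v ∈ E_α` iff `2⟪w, v⟫ + q(v) >
0`, with `2w` the gradient of `q` at `p`. Averaging over `v` and `-v` cancels the odd part: only the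
region where `|q|` dominates `2|⟪w, v⟫|` survives, with the sign of `q`
(`hasNonlocalMeanCurvature_of_quadratic`). The function `h = |q| / (2|⟪w, v⟫|)` has degree one, so
on the ray through a unit vector `ω` the kernel contributes `∫ r^(-1-s) dr` over `r > 1/h(ω)`, that
is `h(ω)^s / s`. Up to a positive constant, the same factor comes from integrating `h^s exp(-|v|²)`
along the ray (`exists_integral_kernel_eq_mul_integral_gaussian`).

A diagonal change of variables turns `q` into a multiple of the light cone form `Q(a, b) = |b|² -
|a|²` and `w` into a multiple of `ν = (-e, f)`. The curvature becomes a positive multiple of `∫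
sign(Q) (|Q|/|⟪ν, x⟫|)^s exp(-|x|² - κQ)`, where `κ = (α²-1)/(α²+1)` holds all the dependence on `α`
(`exists_hasNonlocalMeanCurvature_solidCone`). As `sign(Q) exp(-κQ)` decreases in `κ` wherever `Q ≠
0`, this moment is strictly decreasing in `α` (`coneMoment_strictAntiOn`), for `s = 0` too.

At `s = 0` it is a positive multiple of the mass of the density on `(α, ∞)` minus that on `(0, α)`
(`exists_coneMoment_zero_eq`), so it vanishes exactly at the median `α₀`. Dominated convergence as
`s → 0` (`tendsto_coneMoment_zero`) preserves the strict signs at fixed points on either side of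
`α₀`; continuity gives a zero between them, and monotonicity confines every zero there. -/

/-! ### Polar coordinates and integrability of Gaussian weights -/

/-- Integration in polar coordinates. -/
theorem lintegral_eq_lintegral_toSphere {E : Type*} [NormedAddCommGroup E] [NormedSpace ℝ E]
    [MeasurableSpace E] [BorelSpace E] [FiniteDimensional ℝ E] [Nontrivial E] (μ : Measure E)
    [μ.IsAddHaarMeasure] {f : E → ENNReal} (hf : Measurable f) :
    ∫⁻ x, f x ∂μ = ∫⁻ ω : Metric.sphere (0 : E) 1,
      (∫⁻ r in Ioi (0 : ℝ), ENNReal.ofReal (r ^ (Module.finrank ℝ E - 1)) * f (r • (ω : E)))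
        ∂μ.toSphere := by
  have hp := μ.measurePreserving_homeomorphUnitSphereProd
  have hc := hp.lintegral_comp (f := fun q => f (q.2.1 • q.1.1)) (by fun_prop)
  have h1 : ∀ x : ({0}ᶜ : Set E), f ((homeomorphUnitSphereProd E x).2.1 •
      (homeomorphUnitSphereProd E x).1.1) = f x := by
    intro x
    congr 1
    have hx : ‖(x : E)‖ ≠ 0 := norm_ne_zero_iff.2 x.2
    simp [smul_smul, hx]
  simp_rw [h1] at hc
  rw [lintegral_subtype_comap (measurableSet_singleton _).compl, restrict_compl_singleton] at hc
  rw [hc, lintegral_prod _ (by fun_prop)]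
  refine lintegral_congr fun ω => ?_
  rw [Measure.volumeIoiPow, lintegral_withDensity_eq_lintegral_mul _ (by fun_prop) (by fun_prop)]
  simp only [Pi.mul_apply]
  rw [lintegral_subtype_comap measurableSet_Ioi
    (fun r : ℝ => ENNReal.ofReal (r ^ (Module.finrank ℝ E - 1)) * f (r • (ω : E)))]

/-- For `h` positively homogeneous of degree one on a cone `A`, the integrals over `A` of the
kernel `‖v‖ ^ (-N - s)` outside the level set `h = 1` and of `h ^ s` against the Gaussian weight are
proportional. -/
theorem exists_lintegral_kernel_eq_mul_lintegral_gaussian {E : Type*} [NormedAddCommGroup E]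
    [NormedSpace ℝ E]
    [MeasurableSpace E] [BorelSpace E] [FiniteDimensional ℝ E] [Nontrivial E] (μ : Measure E)
    [μ.IsAddHaarMeasure] {s : ℝ} (hs : 0 < s) :
    ∃ K : ℝ, 0 < K ∧ ∀ (A : Set E) (h : E → ℝ) (J : Set ℝ), MeasurableSet A → Measurable h →
      MeasurableSet J → Ioi 1 ⊆ J → J ⊆ Ici 1 →
      (∀ r : ℝ, 0 < r → ∀ x, r • x ∈ A ↔ x ∈ A) →
      (∀ r : ℝ, 0 < r → ∀ x, h (r • x) = r * h x) →
      (∀ x ∈ A, 0 < h x) →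
      ∫⁻ x in A ∩ h ⁻¹' J, ENNReal.ofReal (1 / ‖x‖ ^ ((Module.finrank ℝ E : ℝ) + s)) ∂μ =
        ENNReal.ofReal K *
          ∫⁻ x in A, ENNReal.ofReal (h x ^ s * Real.exp (-‖x‖ ^ 2)) ∂μ := by
  set N := Module.finrank ℝ E with hN
  have hNpos : 0 < N := Module.finrank_pos
  set G : ℝ := ∫ r in Ioi (0 : ℝ), r ^ ((N : ℝ) - 1 + s) * Real.exp (-r ^ 2) with hG
  have hGint : IntegrableOn (fun r : ℝ => r ^ ((N : ℝ) - 1 + s) * Real.exp (-r ^ 2)) (Ioi 0) := by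
    have := integrableOn_rpow_mul_exp_neg_mul_sq (b := 1) one_pos (s := (N : ℝ) - 1 + s) (by
      have : (1 : ℝ) ≤ N := by exact_mod_cast hNpos
      linarith)
    simpa using this
  have hGpos : 0 < G := by
    rw [hG]
    refine (setIntegral_pos_iff_support_of_nonneg_ae ?_ hGint).2 ?_
    · filter_upwards [ae_restrict_mem measurableSet_Ioi] with r hr
      have : (0 : ℝ) < r := hr
      simp only [Pi.zero_apply]; positivity
    · refine lt_of_lt_of_le (b := volume (Ioi (0 : ℝ))) (by simp) (measure_mono fun r hr => ?_)
      have : (0 : ℝ) < r := hr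
      refine ⟨?_, hr⟩
      simp only [Function.mem_support]; positivity
  -- On the ray through a unit `ω ∈ A` the kernel integrates to `h(ω)^s / s` and the Gaussian side
  -- to `h(ω)^s * G`; the constant is their ratio.
  refine ⟨1 / (s * G), by positivity, ?_⟩
  intro A h J hA hh hJ hJ1 hJ2 hAhom hhom hpos
  rw [← lintegral_indicator (hA.inter (hh hJ)), ← lintegral_indicator hA,
    lintegral_eq_lintegral_toSphere μ (by
      refine Measurable.indicator ?_ (hA.inter (hh hJ)); fun_prop),
    lintegral_eq_lintegral_toSphere μ (by
      refine Measurable.indicator ?_ hA; fun_prop),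
    ← lintegral_const_mul' _ _ ENNReal.ofReal_ne_top]
  refine lintegral_congr fun ω => ?_
  have hω : ‖(ω : E)‖ = 1 := by simp
  by_cases hωA : (ω : E) ∈ A
  · have hhω := hpos _ hωA
    set c := h ω with hc
    have e1 : ∫⁻ r in Ioi (0 : ℝ), ENNReal.ofReal (r ^ (N - 1)) *
        (A ∩ h ⁻¹' J).indicator
          (fun x => ENNReal.ofReal (1 / ‖x‖ ^ ((N : ℝ) + s))) (r • (ω : E)) =
        ENNReal.ofReal (c ^ s / s) := by
      have hint : IntegrableOn (fun r : ℝ => r ^ (-1 - s)) (Ioi c⁻¹) :=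
        integrableOn_Ioi_rpow_of_lt (by linarith) (by positivity)
      have : c ^ s / s = ∫ r in Ioi c⁻¹, r ^ (-1 - s) := by
        rw [integral_Ioi_rpow_of_lt (by linarith) (by positivity), Real.inv_rpow hhω.le,
          ← Real.rpow_neg hhω.le]
        have : -(-1 - s + 1) = s := by ring
        rw [this]
        have : -1 - s + 1 = -s := by ring
        rw [this, neg_div_neg_eq]
      rw [this, ofReal_integral_eq_lintegral_ofReal hint (by
        filter_upwards [ae_restrict_mem measurableSet_Ioi] with r hr
        have : (0 : ℝ) < r := lt_trans (by positivity) hr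
        simp only [Pi.zero_apply]; positivity)]
      have hsub : Ioi c⁻¹ ⊆ Ioi (0 : ℝ) := Ioi_subset_Ioi (by positivity)
      rw [← lintegral_indicator measurableSet_Ioi, ← lintegral_indicator measurableSet_Ioi]
      refine lintegral_congr_ae ?_
      -- The radius `1 / h(ω)`, where `h = 1`, is discarded: whether `1 ∈ J` is left open.
      filter_upwards [compl_mem_ae_iff.2 (measure_singleton (μ := (volume : Measure ℝ)) c⁻¹)]
        with r hr
      have hr : r ≠ c⁻¹ := hr
      by_cases h0 : 0 < r
      · have hrA : r • (ω : E) ∈ A := (hAhom r h0 _).2 hωA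
        rw [indicator_of_mem (mem_Ioi.2 h0)]
        rcases lt_or_gt_of_ne hr with h1 | h1
        · rw [indicator_of_notMem (s := Ioi c⁻¹) (by simpa using h1.le), indicator_of_notMem,
            mul_zero]
          rintro ⟨-, hm⟩
          have := hJ2 hm
          rw [hhom r h0, mem_Ici] at this
          have h2 : r * c < 1 := by
            calc r * c < c⁻¹ * c := by gcongr
              _ = 1 := inv_mul_cancel₀ hhω.ne'
          linarith
        · rw [indicator_of_mem (s := Ioi c⁻¹) h1, indicator_of_mem, ← ENNReal.ofReal_mul (by positivity)]
          · congr 1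
            rw [norm_smul, hω, mul_one, Real.norm_of_nonneg h0.le, ← Real.rpow_natCast,
              mul_one_div, ← Real.rpow_sub h0, Nat.cast_sub hNpos]
            congr 1
            push_cast; ring
          · refine ⟨hrA, hJ1 ?_⟩
            rw [mem_Ioi, hhom r h0]
            calc 1 = c⁻¹ * c := (inv_mul_cancel₀ hhω.ne').symm
              _ < r * c := by gcongr
      · rw [indicator_of_notMem (by simpa using h0),
          indicator_of_notMem (fun hm => h0 (hsub hm))]
    have e2 : ∫⁻ r in Ioi (0 : ℝ), ENNReal.ofReal (r ^ (N - 1)) *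
        A.indicator (fun x => ENNReal.ofReal (h x ^ s * Real.exp (-‖x‖ ^ 2))) (r • (ω : E)) =
        ENNReal.ofReal (c ^ s * G) := by
      rw [hG, ← integral_const_mul, ofReal_integral_eq_lintegral_ofReal (hGint.const_mul _) (by
        filter_upwards [ae_restrict_mem measurableSet_Ioi] with r hr
        have : (0 : ℝ) < r := hr
        simp only [Pi.zero_apply]; positivity)]
      refine setLIntegral_congr_fun measurableSet_Ioi fun r hr => ?_
      have h0 : (0 : ℝ) < r := hr
      have hrA : r • (ω : E) ∈ A := (hAhom r h0 _).2 hωA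
      rw [indicator_of_mem hrA, ← ENNReal.ofReal_mul (by positivity), hhom r h0, norm_smul, hω,
        mul_one, Real.norm_of_nonneg h0.le, Real.mul_rpow h0.le hhω.le, Real.rpow_add h0,
        ← Real.rpow_natCast, Nat.cast_sub hNpos]
      congr 1
      push_cast; ring
    rw [e1, e2, ← ENNReal.ofReal_mul (by positivity)]
    congr 1
    field_simp
  · have h1 : ∀ r ∈ Ioi (0 : ℝ), r • (ω : E) ∉ A := fun r hr hm => hωA ((hAhom r hr _).1 hm)
    have h2 : ∀ f : E → ENNReal, (∀ x, x ∉ A → f x = 0) → ∫⁻ r in Ioi (0 : ℝ),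
        ENNReal.ofReal (r ^ (N - 1)) * f (r • (ω : E)) = 0 := fun f hf => by
      rw [setLIntegral_congr_fun (g := fun _ => 0) measurableSet_Ioi (fun r hr => by
        simp only; rw [hf _ (h1 r hr), mul_zero]), lintegral_zero]
    rw [h2 ((A ∩ h ⁻¹' J).indicator _) fun x hx => indicator_of_notMem (fun hm => hx hm.1) _,
      h2 (A.indicator _) fun x hx => indicator_of_notMem hx _, mul_zero]

/-- Negative powers of a nonzero linear functional, of exponent above `-1`, are integrable against
Gaussian weights. -/
theorem integrable_abs_inner_rpow_mul_exp_neg_norm_sq {V : Type*} [NormedAddCommGroup V]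
    [InnerProductSpace ℝ V] [FiniteDimensional ℝ V] [MeasurableSpace V] [BorelSpace V]
    {ν : V} (hν : ν ≠ 0) {c s : ℝ} (hc : 0 < c) (hs : -1 < s) :
    Integrable (fun x : V => |inner ℝ ν x| ^ s * Real.exp (-c * ‖x‖ ^ 2)) := by
  have : Nontrivial V := ⟨ν, 0, hν⟩
  have h1 : Integrable (fun t : ℝ => |t| ^ s * Real.exp (-c * t ^ 2)) := by
    have := (integrable_fun_norm_addHaar (volume : Measure ℝ)
      (f := fun t => t ^ s * Real.exp (-c * t ^ 2))).2 (by
        simpa using integrableOn_rpow_mul_exp_neg_mul_sq hc hs)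
    simpa using this
  have h0 : Integrable (fun t : ℝ => Real.exp (-c * t ^ 2)) := integrable_exp_neg_mul_sq hc
  let b := stdOrthonormalBasis ℝ V
  let i₀ : Fin (Module.finrank ℝ V) := ⟨0, Module.finrank_pos⟩
  have hpi : Integrable (fun y : Fin (Module.finrank ℝ V) → ℝ =>
      ∏ i, (if i = i₀ then fun t : ℝ => |t| ^ s * Real.exp (-c * t ^ 2)
        else fun t : ℝ => Real.exp (-c * t ^ 2)) (y i)) := by
    refine Integrable.fintype_prod (μ := fun _ => volume) fun i => ?_
    split_ifs
    exacts [h1, h0]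
  -- This reflection carries `ν` to `‖ν‖ • b i₀`, so the functional becomes a multiple of one
  -- coordinate and the integrand factors into one-variable functions.
  let R : V ≃ₗᵢ[ℝ] V := (ℝ ∙ (ν - ‖ν‖ • b i₀))ᗮ.reflection
  have hR : R ν = ‖ν‖ • b i₀ := Submodule.reflection_sub (by
    rw [norm_smul, b.norm_eq_one, mul_one, norm_norm])
  let φ : V ≃ₗᵢ[ℝ] EuclideanSpace ℝ (Fin (Module.finrank ℝ V)) := R.trans b.repr
  have hφ : MeasurePreserving φ := φ.measurePreserving
  have hmp := (EuclideanSpace.volume_preserving_symm_measurableEquiv_toLp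
    (Fin (Module.finrank ℝ V))).comp hφ
  have hcomp := (hmp.integrable_comp hpi.aestronglyMeasurable).2 hpi
  refine (hcomp.const_mul (‖ν‖ ^ s)).congr (Eventually.of_forall fun x => ?_)
  have hin : inner ℝ ν x = ‖ν‖ * φ x i₀ := by
    rw [← R.inner_map_map, hR, inner_smul_left]
    simp [φ, b.repr_apply_apply]
  have hnorm : ‖x‖ ^ 2 = ∑ i, φ x i ^ 2 := by
    rw [← φ.norm_map, EuclideanSpace.real_norm_sq_eq]
  simp only [Function.comp_apply]
  have hprod : ∀ y : Fin (Module.finrank ℝ V) → ℝ,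
      ∏ i, (if i = i₀ then fun t : ℝ => |t| ^ s * Real.exp (-c * t ^ 2)
        else fun t : ℝ => Real.exp (-c * t ^ 2)) (y i) =
      |y i₀| ^ s * Real.exp (-c * ∑ i, y i ^ 2) := by
    intro y
    rw [Finset.mul_sum, Real.exp_sum]
    rw [← Finset.mul_prod_erase _ _ (Finset.mem_univ i₀),
      ← Finset.mul_prod_erase (f := fun i => Real.exp (-c * y i ^ 2)) _ (Finset.mem_univ i₀)]
    rw [if_pos rfl, mul_assoc]
    congr 2
    refine Finset.prod_congr rfl fun i hi => ?_
    rw [if_neg (Finset.ne_of_mem_erase hi)]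
  rw [hprod, hin, hnorm, abs_mul, abs_norm, Real.mul_rpow (norm_nonneg _) (abs_nonneg _), mul_assoc]
  rfl

theorem integrable_exp_neg_mul_norm_sq {V : Type*} [NormedAddCommGroup V]
    [InnerProductSpace ℝ V] [FiniteDimensional ℝ V] [MeasurableSpace V] [BorelSpace V]
    {c : ℝ} (hc : 0 < c) : Integrable (fun x : V => Real.exp (-c * ‖x‖ ^ 2)) := by
  cases subsingleton_or_nontrivial V with
  | inl h =>
    have : IsFiniteMeasure (volume : Measure V) :=
      ⟨((Set.subsingleton_univ (α := V)).finite.isCompact).measure_lt_top⟩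
    exact Integrable.of_bound (by fun_prop) 1 (Eventually.of_forall fun x => by
      rw [Real.norm_eq_abs, Real.abs_exp, Real.exp_le_one_iff]
      have := sq_nonneg ‖x‖
      nlinarith)
  | inr h =>
    obtain ⟨ν, hν⟩ := exists_ne (0 : V)
    simpa using integrable_abs_inner_rpow_mul_exp_neg_norm_sq hν hc (s := 0) (by norm_num)

/-- A hyperplane is a null set. -/
theorem ae_inner_ne_zero {V : Type*} [NormedAddCommGroup V]
    [InnerProductSpace ℝ V] [FiniteDimensional ℝ V] [MeasurableSpace V] [BorelSpace V]
    {ν : V} (hν : ν ≠ 0) : ∀ᵐ x : V, inner ℝ ν x ≠ 0 := by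
  have := Measure.addHaar_submodule (volume : Measure V) (LinearMap.ker (innerₛₗ ℝ ν)) (by
    intro h
    have : ν ∈ LinearMap.ker (innerₛₗ ℝ ν) := by rw [h]; trivial
    simp [hν] at this)
  rw [ae_iff]
  convert! this using 2
  ext x
  simp

/-! ### The moment on the light cone and its dependence on `s` and `κ` -/

noncomputable section

/-- The quadratic form `|b|² - |a|²` of `(a, b) ∈ ℝ^m × ℝ^n`. -/
def lightconeForm {m n : ℕ} (x : ProdSpace m n) : ℝ := ‖x.snd‖ ^ 2 - ‖x.fst‖ ^ 2

/-- The vector `(-e, f)`, normal to the light cone at `(e, f)`. -/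
def lightconeNormal {m n : ℕ} (e : EuclideanSpace ℝ (Fin m)) (f : EuclideanSpace ℝ (Fin n)) :
    ProdSpace m n := WithLp.toLp 2 (-e, f)

/-- The signed integrand whose integral has the sign of the nonlocal mean curvature of a cone. -/
def coneMomentIntegrand {m n : ℕ} (ν : ProdSpace m n) (s κ : ℝ) (x : ProdSpace m n) : ℝ :=
  Real.sign (lightconeForm x) * (|lightconeForm x| / |inner ℝ ν x|) ^ s *
    Real.exp (-‖x‖ ^ 2 - κ * lightconeForm x)

/-- The integral that has the sign of the nonlocal mean curvature of a cone. -/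
def coneMoment {m n : ℕ} (ν : ProdSpace m n) (s κ : ℝ) : ℝ := ∫ x, coneMomentIntegrand ν s κ x

end

variable {m n : ℕ}

@[fun_prop]
theorem continuous_lightconeForm : Continuous (lightconeForm : ProdSpace m n → ℝ) := by
  unfold lightconeForm
  have h1 : Continuous fun x : ProdSpace m n => x.snd := WithLp.prod_continuous_ofLp .. |>.snd
  have h2 : Continuous fun x : ProdSpace m n => x.fst := WithLp.prod_continuous_ofLp .. |>.fst
  fun_prop

@[fun_prop]
theorem measurable_lightconeForm : Measurable (lightconeForm : ProdSpace m n → ℝ) :=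
  continuous_lightconeForm.measurable

theorem norm_sq_eq_fst_add_snd (x : ProdSpace m n) : ‖x‖ ^ 2 = ‖x.fst‖ ^ 2 + ‖x.snd‖ ^ 2 :=
  WithLp.prod_norm_sq_eq_of_L2 x

theorem abs_lightconeForm_le (x : ProdSpace m n) : |lightconeForm x| ≤ ‖x‖ ^ 2 := by
  rw [norm_sq_eq_fst_add_snd, lightconeForm, abs_le]
  constructor <;> nlinarith [sq_nonneg ‖x.fst‖, sq_nonneg ‖x.snd‖]

theorem measurable_sign : Measurable Real.sign := by
  unfold Real.sign
  exact Measurable.ite measurableSet_Iio measurable_const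
    (Measurable.ite measurableSet_Ioi measurable_const measurable_const)

theorem measurable_coneMomentIntegrand (ν : ProdSpace m n) (s κ : ℝ) :
    Measurable (coneMomentIntegrand ν s κ) := by
  unfold coneMomentIntegrand
  have := measurable_sign.comp (measurable_lightconeForm (m := m) (n := n))
  simp only [Function.comp_def] at this
  fun_prop

theorem abs_sign_le_one (t : ℝ) : |Real.sign t| ≤ 1 := by
  rcases Real.sign_apply_eq t with h | h | h <;> simp [h]

/-- The bound is uniform in `s ∈ [0, 1/2]` and `|κ| ≤ k`, so one dominating function serves limits
in either parameter. The singularity on the hyperplane `ν^⊥` has exponent `-1/2 > -1`, hence is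
integrable. -/
theorem norm_coneMomentIntegrand_le (ν : ProdSpace m n) {s κ k : ℝ} (hs : s ∈ Icc (0 : ℝ) (1 / 2))
    (hκ : |κ| ≤ k) (x : ProdSpace m n) :
    ‖coneMomentIntegrand ν s κ x‖ ≤ (1 + ‖x‖ * |inner ℝ ν x| ^ (-(1 / 2) : ℝ)) *
      Real.exp (-(1 - k) * ‖x‖ ^ 2) := by
  have hQ := abs_lightconeForm_le x
  rw [coneMomentIntegrand, norm_mul, norm_mul, Real.norm_eq_abs, Real.norm_eq_abs, Real.norm_eq_abs,
    Real.abs_exp]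
  have hpow : |(|lightconeForm x| / |inner ℝ ν x|) ^ s| ≤
      1 + ‖x‖ * |inner ℝ ν x| ^ (-(1 / 2) : ℝ) := by
    set t := |lightconeForm x| / |inner ℝ ν x| with ht
    have ht0 : 0 ≤ t := by positivity
    rw [abs_of_nonneg (by positivity)]
    rcases le_or_gt t 1 with h1 | h1
    · exact (Real.rpow_le_one ht0 h1 hs.1).trans (by
        have : 0 ≤ ‖x‖ * |inner ℝ ν x| ^ (-(1 / 2) : ℝ) := by positivity
        linarith)
    · calc t ^ s ≤ t ^ (1 / 2 : ℝ) := Real.rpow_le_rpow_of_exponent_le h1.le hs.2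
        _ = |lightconeForm x| ^ (1 / 2 : ℝ) * |inner ℝ ν x| ^ (-(1 / 2) : ℝ) := by
          rw [ht, Real.div_rpow (abs_nonneg _) (abs_nonneg _), Real.rpow_neg (abs_nonneg _),
            div_eq_mul_inv]
        _ ≤ ‖x‖ * |inner ℝ ν x| ^ (-(1 / 2) : ℝ) := by
          gcongr
          rw [← Real.sqrt_eq_rpow]
          exact Real.sqrt_le_iff.2 ⟨norm_nonneg _, hQ⟩
        _ ≤ _ := by linarith
  have hexp : -‖x‖ ^ 2 - κ * lightconeForm x ≤ -(1 - k) * ‖x‖ ^ 2 := by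
    have : -(κ * lightconeForm x) ≤ k * ‖x‖ ^ 2 := by
      calc -(κ * lightconeForm x) ≤ |κ * lightconeForm x| := neg_le_abs _
        _ = |κ| * |lightconeForm x| := abs_mul _ _
        _ ≤ k * ‖x‖ ^ 2 := by gcongr; exact (abs_nonneg _).trans hκ
    linarith
  have h3 := abs_sign_le_one (lightconeForm x)
  calc _ ≤ 1 * (1 + ‖x‖ * |inner ℝ ν x| ^ (-(1 / 2) : ℝ)) * Real.exp (-(1 - k) * ‖x‖ ^ 2) := by
        gcongr
    _ = _ := by rw [one_mul]

theorem integrable_coneMoment_bound {ν : ProdSpace m n} (hν : ν ≠ 0) {k : ℝ} (hk : k < 1) :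
    Integrable (fun x => (1 + ‖x‖ * |inner ℝ ν x| ^ (-(1 / 2) : ℝ)) *
      Real.exp (-(1 - k) * ‖x‖ ^ 2)) := by
  set ε := 1 - k with hε
  have hε0 : 0 < ε := by linarith
  have h1 := integrable_exp_neg_mul_norm_sq (V := ProdSpace m n) hε0
  have h2 := (integrable_abs_inner_rpow_mul_exp_neg_norm_sq hν (half_pos hε0)
    (s := -(1 / 2)) (by norm_num)).const_mul (1 + 2 / ε)
  refine (h1.add h2).mono' (by fun_prop) (Eventually.of_forall fun x => ?_)
  rw [Real.norm_of_nonneg (by positivity), add_mul, one_mul, Pi.add_apply]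
  refine add_le_add le_rfl ?_
  -- Half of the Gaussian decay absorbs the factor `‖x‖`.
  have hx : ‖x‖ ≤ (1 + 2 / ε) * Real.exp (ε / 2 * ‖x‖ ^ 2) := by
    have := Real.add_one_le_exp (ε / 2 * ‖x‖ ^ 2)
    calc ‖x‖ ≤ 1 + ‖x‖ ^ 2 := by nlinarith [sq_nonneg (‖x‖ - 1)]
      _ ≤ (1 + 2 / ε) * (ε / 2 * ‖x‖ ^ 2 + 1) := by
        have : (1 + 2 / ε) * (ε / 2 * ‖x‖ ^ 2 + 1) =
          1 + ‖x‖ ^ 2 + (2 / ε + ε / 2 * ‖x‖ ^ 2) := by field_simp; ring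
        rw [this]
        have : 0 ≤ 2 / ε + ε / 2 * ‖x‖ ^ 2 := by positivity
        linarith
      _ ≤ _ := by gcongr
  calc ‖x‖ * |inner ℝ ν x| ^ (-(1 / 2) : ℝ) * Real.exp (-ε * ‖x‖ ^ 2)
      ≤ (1 + 2 / ε) * Real.exp (ε / 2 * ‖x‖ ^ 2) * |inner ℝ ν x| ^ (-(1 / 2) : ℝ) *
        Real.exp (-ε * ‖x‖ ^ 2) := by gcongr
    _ = (1 + 2 / ε) * (|inner ℝ ν x| ^ (-(1 / 2) : ℝ) *
        (Real.exp (ε / 2 * ‖x‖ ^ 2) * Real.exp (-ε * ‖x‖ ^ 2))) := by ring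
    _ = _ := by
      rw [← Real.exp_add]
      congr 4
      ring

theorem integrable_coneMomentIntegrand {ν : ProdSpace m n} (hν : ν ≠ 0) {s κ : ℝ}
    (hs : s ∈ Icc (0 : ℝ) (1 / 2)) (hκ : |κ| < 1) : Integrable (coneMomentIntegrand ν s κ) :=
  (integrable_coneMoment_bound hν hκ).mono' (measurable_coneMomentIntegrand ..).aestronglyMeasurable
    (Eventually.of_forall (norm_coneMomentIntegrand_le ν hs le_rfl))

theorem continuousOn_coneMoment {ν : ProdSpace m n} (hν : ν ≠ 0) {s k : ℝ}
    (hs : s ∈ Icc (0 : ℝ) (1 / 2)) (hk : k < 1) : ContinuousOn (coneMoment ν s) (Icc (-k) k) := by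
  refine continuousOn_of_dominated
    (fun κ _ => (measurable_coneMomentIntegrand ν s κ).aestronglyMeasurable)
    (fun κ hκ => Eventually.of_forall (norm_coneMomentIntegrand_le ν hs (abs_le.2 hκ)))
    (integrable_coneMoment_bound hν hk) (Eventually.of_forall fun x => ?_)
  unfold coneMomentIntegrand
  fun_prop

theorem tendsto_coneMoment_zero {ν : ProdSpace m n} (hν : ν ≠ 0) {κ : ℝ} (hκ : |κ| < 1) :
    Tendsto (fun s => coneMoment ν s κ) (𝓝[>] 0) (𝓝 (coneMoment ν 0 κ)) := by
  refine tendsto_integral_filter_of_dominated_convergence _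
    (Eventually.of_forall fun s => (measurable_coneMomentIntegrand ν s κ).aestronglyMeasurable)
    ?_ (integrable_coneMoment_bound hν hκ) ?_
  · filter_upwards [Ioo_mem_nhdsGT (show (0 : ℝ) < 1 / 2 by norm_num)] with s hs
    exact Eventually.of_forall (norm_coneMomentIntegrand_le ν ⟨hs.1.le, hs.2.le⟩ le_rfl)
  -- Off the hyperplane the base of the power vanishes only where `Q = 0`, and there the sign factor
  -- is `0`; so the jump of `0 ^ s` at `s = 0` does no harm.
  · filter_upwards [ae_inner_ne_zero hν] with x hx
    unfold coneMomentIntegrand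
    by_cases hQ : lightconeForm x = 0
    · simp [hQ]
    · refine (Tendsto.const_mul _ ?_).mul_const _
      have h0 : |lightconeForm x| / |inner ℝ ν x| ≠ 0 := by positivity
      exact ((Real.continuous_const_rpow h0).tendsto 0).mono_left nhdsWithin_le_nhds

/-- The monotonicity is pointwise: where `Q > 0` the factor `exp(-κQ)` decreases in `κ`, and where
`Q < 0` it increases but enters with a minus sign. It is strict on a nonempty open set, which has
positive measure. -/
theorem coneMoment_strictAntiOn {ν : ProdSpace m n} (hν : ν ≠ 0)
    (hpos : ∃ x : ProdSpace m n, lightconeForm x ≠ 0 ∧ inner ℝ ν x ≠ 0) {s : ℝ}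
    (hs : s ∈ Icc (0 : ℝ) (1 / 2)) : StrictAntiOn (coneMoment ν s) (Ioo (-1) 1) := by
  intro κ₁ h₁ κ₂ h₂ hlt
  have hi₁ := integrable_coneMomentIntegrand hν hs (abs_lt.2 h₁)
  have hi₂ := integrable_coneMomentIntegrand hν hs (abs_lt.2 h₂)
  rw [← sub_pos, coneMoment, coneMoment, ← integral_sub hi₁ hi₂]
  have hform : ∀ x, coneMomentIntegrand ν s κ₁ x - coneMomentIntegrand ν s κ₂ x =
      (|lightconeForm x| / |inner ℝ ν x|) ^ s * (Real.sign (lightconeForm x) *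
        (Real.exp (-‖x‖ ^ 2 - κ₁ * lightconeForm x) -
          Real.exp (-‖x‖ ^ 2 - κ₂ * lightconeForm x))) := by
    intro x; unfold coneMomentIntegrand; ring
  have key : ∀ x : ProdSpace m n, lightconeForm x ≠ 0 → 0 < Real.sign (lightconeForm x) *
        (Real.exp (-‖x‖ ^ 2 - κ₁ * lightconeForm x) -
          Real.exp (-‖x‖ ^ 2 - κ₂ * lightconeForm x)) := by
    intro x hx
    rcases lt_or_gt_of_ne hx with h | h
    · rw [Real.sign_of_neg h, neg_one_mul, neg_sub, sub_pos, Real.exp_lt_exp]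
      nlinarith
    · rw [Real.sign_of_pos h, one_mul, sub_pos, Real.exp_lt_exp]
      nlinarith
  refine (integral_pos_iff_support_of_nonneg (fun x => ?_) (hi₁.sub hi₂)).2 ?_
  · rw [Pi.zero_apply, Pi.sub_apply, hform]
    by_cases hx : lightconeForm x = 0
    · simp [hx]
    · exact mul_nonneg (by positivity) (key x hx).le
  · have hopen : IsOpen {x : ProdSpace m n | lightconeForm x ≠ 0 ∧ inner ℝ ν x ≠ 0} :=
      (isOpen_ne_fun continuous_lightconeForm continuous_const).inter
        (isOpen_ne_fun (by fun_prop) continuous_const)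
    refine lt_of_lt_of_le (hopen.measure_pos volume hpos) (measure_mono fun x hx => ?_)
    rw [Function.mem_support, Pi.sub_apply, hform]
    exact (mul_pos (Real.rpow_pos_of_pos (div_pos (abs_pos.2 hx.1) (abs_pos.2 hx.2)) s)
      (key x hx.1)).ne'

theorem inner_lightconeNormal (e : EuclideanSpace ℝ (Fin m)) (f : EuclideanSpace ℝ (Fin n))
    (x : ProdSpace m n) :
    inner ℝ (lightconeNormal e f) x = inner ℝ f x.snd - inner ℝ e x.fst := by
  rw [WithLp.prod_inner_apply]
  simp [lightconeNormal]
  ring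

theorem lightconeNormal_ne_zero {e : EuclideanSpace ℝ (Fin m)} {f : EuclideanSpace ℝ (Fin n)}
    (hf : ‖f‖ = 1) : lightconeNormal e f ≠ 0 := by
  intro h
  have : f = 0 := congrArg WithLp.snd h
  simp [this] at hf

theorem exists_lightconeForm_ne_zero {e : EuclideanSpace ℝ (Fin m)}
    {f : EuclideanSpace ℝ (Fin n)} (hf : ‖f‖ = 1) :
    ∃ x : ProdSpace m n, lightconeForm x ≠ 0 ∧ inner ℝ (lightconeNormal e f) x ≠ 0 := by
  refine ⟨WithLp.toLp 2 (0, f), ?_, ?_⟩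
  · simp [lightconeForm, hf]
  · rw [inner_lightconeNormal]
    simp [hf]

/-- The moment does not depend on the point of the light cone. -/
theorem coneMoment_lightconeNormal_eq {e e' : EuclideanSpace ℝ (Fin m)}
    {f f' : EuclideanSpace ℝ (Fin n)} (he : ‖e‖ = ‖e'‖) (hf : ‖f‖ = ‖f'‖) (s κ : ℝ) :
    coneMoment (lightconeNormal e f) s κ = coneMoment (lightconeNormal e' f') s κ := by
  let R₁ : EuclideanSpace ℝ (Fin m) ≃ₗᵢ[ℝ] EuclideanSpace ℝ (Fin m) := (ℝ ∙ (e - e'))ᗮ.reflection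
  let R₂ : EuclideanSpace ℝ (Fin n) ≃ₗᵢ[ℝ] EuclideanSpace ℝ (Fin n) := (ℝ ∙ (f - f'))ᗮ.reflection
  have h₁ : R₁ e = e' := Submodule.reflection_sub he
  have h₂ : R₂ f = f' := Submodule.reflection_sub hf
  let R : ProdSpace m n ≃ₗᵢ[ℝ] ProdSpace m n := LinearIsometryEquiv.withLpProdCongr 2 R₁ R₂
  have hfst : ∀ x, (R x).fst = R₁ x.fst := fun x => rfl
  have hsnd : ∀ x, (R x).snd = R₂ x.snd := fun x => rfl
  unfold coneMoment
  rw [← (R.measurePreserving).integral_comp R.toHomeomorph.measurableEmbedding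
    (coneMomentIntegrand (lightconeNormal e' f') s κ)]
  refine integral_congr_ae (Eventually.of_forall fun x => ?_)
  simp only [coneMomentIntegrand, inner_lightconeNormal, lightconeForm, hfst, hsnd, R.norm_map,
    R₁.norm_map, R₂.norm_map]
  rw [← h₁, ← h₂, R₁.inner_map_map, R₂.inner_map_map]

/-! ### Symmetrization at a point of the cone and passage to Gaussian weights -/

/-- For `‖v‖ ≥ δ` one has `1 + ‖v‖ ≤ (1 + 1/δ) ‖v‖`, so the kernel is dominated by a multiple of `(1
+ ‖v‖) ^ (-N - s)`. -/
theorem integrableOn_compl_ball_one_div_norm_rpow {V : Type*} [NormedAddCommGroup V]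
    [InnerProductSpace ℝ V] [FiniteDimensional ℝ V] [MeasurableSpace V] [BorelSpace V]
    {s δ : ℝ} (hs : 0 < s) (hδ : 0 < δ) :
    IntegrableOn (fun v : V => 1 / ‖v‖ ^ ((Module.finrank ℝ V : ℝ) + s))
      (Metric.ball 0 δ)ᶜ volume := by
  set N : ℝ := (Module.finrank ℝ V : ℝ) + s with hN
  have hN0 : 0 < N := by positivity
  have h := (integrable_one_add_norm (μ := (volume : Measure V)) (r := N) (by linarith)).const_mul
    ((1 + 1 / δ) ^ N)
  refine h.integrableOn.mono' (Measurable.aestronglyMeasurable (by fun_prop)) ?_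
  filter_upwards [ae_restrict_mem Metric.isOpen_ball.measurableSet.compl] with v hv
  have hv : δ ≤ ‖v‖ := by simpa using hv
  have hv0 : 0 < ‖v‖ := hδ.trans_le hv
  rw [Real.norm_of_nonneg (by positivity), Real.rpow_neg (by positivity), ← div_eq_mul_inv,
    ← Real.div_rpow (by positivity) (by positivity), one_div, ← Real.inv_rpow (by positivity)]
  refine Real.rpow_le_rpow (by positivity) ?_ hN0.le
  rw [inv_eq_one_div, div_le_div_iff₀ hv0 (by positivity), one_mul, add_mul, one_mul]
  have : 1 ≤ 1 / δ * ‖v‖ := by rw [one_div_mul_eq_div, le_div_iff₀ hδ]; linarith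
  linarith

open Classical in
/-- Suppose that, along each line through `p`, membership in `E` is decided by the sign of
`2 ⟪w, v⟫ + q v` with `q` even. Averaging over `v` and `-v` turns the principal value into an
absolutely convergent integral. -/
theorem hasNonlocalMeanCurvature_of_quadratic {V : Type*} [NormedAddCommGroup V]
    [InnerProductSpace ℝ V] [FiniteDimensional ℝ V] [MeasurableSpace V] [BorelSpace V]
    {s : ℝ} (hs : 0 < s) {E : Set V} (hE : MeasurableSet E) {p w : V} {q : V → ℝ}
    (hqneg : ∀ v, q (-v) = q v)
    (hmem : ∀ v, p + v ∈ E ↔ 0 < 2 * inner ℝ w v + q v)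
    (hint : Integrable (fun v => (({v | 2 * |inner ℝ w v| < q v}.indicator (fun _ => (1 : ℝ)) v -
      {v | q v ≤ -(2 * |inner ℝ w v|)}.indicator (fun _ => (1 : ℝ)) v) *
        (1 / ‖v‖ ^ ((Module.finrank ℝ V : ℝ) + s))))) :
    HasNonlocalMeanCurvature s E p
      (∫ v, (({v | 2 * |inner ℝ w v| < q v}.indicator (fun _ => (1 : ℝ)) v -
        {v | q v ≤ -(2 * |inner ℝ w v|)}.indicator (fun _ => (1 : ℝ)) v) *
          (1 / ‖v‖ ^ ((Module.finrank ℝ V : ℝ) + s)))) := by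
  set k : V → ℝ := fun v => 1 / ‖v‖ ^ ((Module.finrank ℝ V : ℝ) + s) with hk
  set τ : V → ℝ := fun v => {v | 2 * |inner ℝ w v| < q v}.indicator (fun _ => (1 : ℝ)) v -
      {v | q v ≤ -(2 * |inner ℝ w v|)}.indicator (fun _ => (1 : ℝ)) v with hτ
  set σ : V → ℝ := fun v => E.indicator (fun _ => (1 : ℝ)) (p + v) -
    Eᶜ.indicator (fun _ => (1 : ℝ)) (p + v) with hσ
  have hmp := measurePreserving_add_left (volume : Measure V) p
  have hemb : MeasurableEmbedding (fun v : V => p + v) := measurableEmbedding_addLeft p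
  have hpre : ∀ δ, (fun v => p + v) ⁻¹' (Metric.ball p δ)ᶜ = (Metric.ball (0 : V) δ)ᶜ := by
    intro δ; ext v; simp
  have hcomp : ∀ v, curvatureIntegrand s E p (p + v) = σ v * k v := by
    intro v
    simp only [curvatureIntegrand, hσ, hk, add_sub_cancel_left, mul_one_div]
  have hσ1 : ∀ v, σ v = if p + v ∈ E then 1 else -1 := by
    intro v
    by_cases h : p + v ∈ E <;> simp [hσ, h]
  have hσm : Measurable σ :=
    ((measurable_const.indicator hE).comp (measurable_const_add p)).sub
      ((measurable_const.indicator hE.compl).comp (measurable_const_add p))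
  have hkneg : ∀ v, k (-v) = k v := fun v => by simp [hk]
  have hσk : ∀ δ > 0, IntegrableOn (fun v => σ v * k v) (Metric.ball 0 δ)ᶜ := by
    intro δ hδ
    refine Integrable.mono (integrableOn_compl_ball_one_div_norm_rpow hs hδ)
      (hσm.mul (show Measurable k by fun_prop)).aestronglyMeasurable
      (Eventually.of_forall fun v => ?_)
    rw [norm_mul, hσ1]
    split_ifs <;> simp [hk]
  -- Both `p + v` and `p - v` lie in `E` iff `q v > 2|⟪w, v⟫|`, both lie outside iff `q v ≤ -2|⟪w,
  -- v⟫|`; otherwise the two signs cancel.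
  have hsym : ∀ v, (σ v + σ (-v)) / 2 = τ v := by
    intro v
    rw [hσ1, hσ1]
    simp only [hmem, hqneg, inner_neg_right, hτ, indicator_apply, mem_ofPred_eq]
    rcases abs_cases (inner ℝ w v) with ⟨h1, h2⟩ | ⟨h1, h2⟩ <;>
      split_ifs <;> first | (exfalso; linarith) | norm_num
  have hval : ∀ δ > 0, ∫ x in (Metric.ball p δ)ᶜ, curvatureIntegrand s E p x =
      ∫ v in (Metric.ball (0 : V) δ)ᶜ, τ v * k v := by
    intro δ hδ
    rw [← hmp.setIntegral_preimage_emb hemb, hpre]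
    simp_rw [hcomp]
    have hneg := (Measure.measurePreserving_neg (volume : Measure V)).setIntegral_preimage_emb
      (MeasurableEquiv.neg V).measurableEmbedding (fun v => σ v * k v) (Metric.ball (0 : V) δ)ᶜ
    have hnegi := ((Measure.measurePreserving_neg (volume : Measure V)).integrableOn_comp_preimage
      (MeasurableEquiv.neg V).measurableEmbedding).2 (hσk δ hδ)
    have hpreneg : Neg.neg ⁻¹' (Metric.ball (0 : V) δ)ᶜ = (Metric.ball (0 : V) δ)ᶜ := by
      ext v; simp
    rw [hpreneg] at hneg hnegi
    have hsum := integral_add (hσk δ hδ) hnegi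
    simp only [Function.comp_def] at hsum
    rw [hneg] at hsum
    have : ∫ v in (Metric.ball (0 : V) δ)ᶜ, τ v * k v =
        ∫ v in (Metric.ball (0 : V) δ)ᶜ, (1 / 2) * (σ v * k v + σ (-v) * k (-v)) := by
      refine integral_congr_ae (Eventually.of_forall fun v => ?_)
      simp only [← hsym, hkneg]
      ring
    rw [this, integral_const_mul, hsum]
    ring
  refine ⟨fun δ hδ => ?_, ?_⟩
  · rw [← hmp.integrableOn_comp_preimage hemb, hpre]
    simpa only [Function.comp_def, hcomp] using hσk δ hδ
  · have hlim : Tendsto (fun δ : ℝ => ∫ v, (Metric.ball (0 : V) δ)ᶜ.indicator (fun v => τ v * k v) v)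
        (𝓝[>] 0) (𝓝 (∫ v, τ v * k v)) := by
      refine tendsto_integral_filter_of_dominated_convergence (fun v => ‖τ v * k v‖)
        (Eventually.of_forall fun δ =>
          hint.aestronglyMeasurable.indicator Metric.isOpen_ball.measurableSet.compl)
        (Eventually.of_forall fun δ => Eventually.of_forall fun v => norm_indicator_le_norm_self _ _)
        hint.norm ?_
      refine Eventually.of_forall fun v => tendsto_const_nhds.congr' ?_
      -- The origin lies in every ball, but there the kernel is `1 / 0 = 0`.
      by_cases hv : v = 0
      · have hN : (Module.finrank ℝ V : ℝ) + s ≠ 0 := by positivity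
        have : k 0 = 0 := by simp [hk, Real.zero_rpow hN]
        refine Eventually.of_forall fun δ => ?_
        rw [hv, this, mul_zero, eq_comm]
        exact indicator_apply_eq_zero.2 fun _ => by rw [this, mul_zero]
      · filter_upwards [Ioo_mem_nhdsGT (norm_pos_iff.2 hv)] with δ hδ
        rw [indicator_of_mem]
        simpa using hδ.2.le
    refine hlim.congr' ?_
    filter_upwards [self_mem_nhdsWithin] with δ hδ
    rw [hval δ hδ, integral_indicator Metric.isOpen_ball.measurableSet.compl]

/-- Polar coordinates replace the singular kernel by a Gaussian weight. -/
theorem exists_integral_kernel_eq_mul_integral_gaussian {V : Type*} [NormedAddCommGroup V]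
    [InnerProductSpace ℝ V] [FiniteDimensional ℝ V] [MeasurableSpace V] [BorelSpace V]
    {s : ℝ} (hs : 0 < s) {w : V} (hw : w ≠ 0) {q : V → ℝ}
    (hq : Measurable q) (hhom : ∀ (r : ℝ) v, q (r • v) = r ^ 2 * q v)
    (hint : Integrable (fun v => Real.sign (q v) * (|q v| / (2 * |inner ℝ w v|)) ^ s *
      Real.exp (-‖v‖ ^ 2))) :
    ∃ K : ℝ, 0 < K ∧
      Integrable (fun v => (({v | 2 * |inner ℝ w v| < q v}.indicator (fun _ => (1 : ℝ)) v -
        {v | q v ≤ -(2 * |inner ℝ w v|)}.indicator (fun _ => (1 : ℝ)) v) *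
          (1 / ‖v‖ ^ ((Module.finrank ℝ V : ℝ) + s)))) ∧
      ∫ v, (({v | 2 * |inner ℝ w v| < q v}.indicator (fun _ => (1 : ℝ)) v -
        {v | q v ≤ -(2 * |inner ℝ w v|)}.indicator (fun _ => (1 : ℝ)) v) *
          (1 / ‖v‖ ^ ((Module.finrank ℝ V : ℝ) + s))) =
      K * ∫ v, Real.sign (q v) * (|q v| / (2 * |inner ℝ w v|)) ^ s * Real.exp (-‖v‖ ^ 2) := by
  have : Nontrivial V := ⟨w, 0, hw⟩
  obtain ⟨K, hK, hKeq⟩ :=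
    exists_lintegral_kernel_eq_mul_lintegral_gaussian (volume : Measure V) hs
  set h : V → ℝ := fun v => |q v| / (2 * |inner ℝ w v|) with hh
  set k : V → ℝ := fun v => 1 / ‖v‖ ^ ((Module.finrank ℝ V : ℝ) + s) with hk
  set g : V → ℝ := fun v => h v ^ s * Real.exp (-‖v‖ ^ 2) with hg
  have hhm : Measurable h := by fun_prop
  have hkm : Measurable k := by fun_prop
  have hgm : Measurable g := by fun_prop
  have hh0 : ∀ v, 0 ≤ h v := fun v => by positivity
  have hg0 : ∀ v, 0 ≤ g v := fun v => mul_nonneg (Real.rpow_nonneg (hh0 v) s) (Real.exp_pos _).le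
  have hk0 : ∀ v, 0 ≤ k v := fun v => by positivity
  have hhhom : ∀ r : ℝ, 0 < r → ∀ x, h (r • x) = r * h x := by
    intro r hr x
    simp only [hh, hhom, inner_smul_right, abs_mul, abs_of_pos hr, abs_of_pos (pow_pos hr 2)]
    by_cases hx : |inner ℝ w x| = 0
    · simp [hx]
    · field_simp
  -- The null hyperplane is removed because `h` is `0` on it, by division by zero, while positivity
  -- of `h` is needed on the cones.
  set A : Set V := {v | 0 < q v ∧ inner ℝ w v ≠ 0} with hA
  set A' : Set V := {v | q v < 0 ∧ inner ℝ w v ≠ 0} with hA'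
  have hL : MeasurableSet {v : V | inner ℝ w v ≠ 0} :=
    (measurableSet_eq_fun (by fun_prop) measurable_const).compl
  have hAm : MeasurableSet A := (measurableSet_lt measurable_const hq).inter hL
  have hAm' : MeasurableSet A' := (measurableSet_lt hq measurable_const).inter hL
  have hAcone : ∀ r : ℝ, 0 < r → ∀ x, r • x ∈ A ↔ x ∈ A := by
    intro r hr x
    simp [hA, hhom, inner_smul_right, hr.ne', pow_pos hr 2]
  have hAcone' : ∀ r : ℝ, 0 < r → ∀ x, r • x ∈ A' ↔ x ∈ A' := by
    intro r hr x
    have : r ^ 2 * q x < 0 ↔ q x < 0 := by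
      constructor <;> intro h <;> nlinarith [pow_pos hr 2]
    simp [hA', hhom, inner_smul_right, hr.ne', this]
  have hgint : Integrable (fun v => |Real.sign (q v)| * g v) := by
    refine hint.norm.congr (Eventually.of_forall fun v => ?_)
    simp only
    rw [mul_assoc, norm_mul, Real.norm_eq_abs]
    congr 1
    exact Real.norm_of_nonneg (hg0 v)
  have key : ∀ (C : Set V) (J : Set ℝ), MeasurableSet C → MeasurableSet J → Ioi 1 ⊆ J →
      J ⊆ Ici 1 → (∀ r : ℝ, 0 < r → ∀ x, r • x ∈ C ↔ x ∈ C) →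
      (∀ x ∈ C, q x ≠ 0 ∧ inner ℝ w x ≠ 0) →
      IntegrableOn k (C ∩ h ⁻¹' J) ∧ IntegrableOn g C ∧
        ∫ v in C ∩ h ⁻¹' J, k v = K * ∫ v in C, g v := by
    intro C J hC hJ hJ1 hJ2 hcone hne
    have hgC : IntegrableOn g C := by
      refine hgint.integrableOn.congr_fun (fun v hv => ?_) hC
      rcases lt_or_gt_of_ne (hne v hv).1 with h1 | h1
      · simp [Real.sign_of_neg h1]
      · simp [Real.sign_of_pos h1]
    have heq := hKeq C h J hC hhm hJ hJ1 hJ2 hcone hhhom (fun x hx => by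
      have := hne x hx
      exact div_pos (abs_pos.2 this.1) (mul_pos two_pos (abs_pos.2 this.2)))
    have hfin : ∫⁻ x in C, ENNReal.ofReal (g x) < ⊤ := hgC.lintegral_lt_top
    refine ⟨⟨hkm.aestronglyMeasurable, ?_⟩, hgC, ?_⟩
    · rw [hasFiniteIntegral_iff_ofReal (Eventually.of_forall hk0)]
      exact heq.trans_lt (ENNReal.mul_lt_top ENNReal.ofReal_lt_top hfin)
    · rw [integral_eq_lintegral_of_nonneg_ae (Eventually.of_forall hk0) hkm.aestronglyMeasurable,
        integral_eq_lintegral_of_nonneg_ae (Eventually.of_forall hg0) hgm.aestronglyMeasurable]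
      refine (congrArg ENNReal.toReal heq).trans ?_
      rw [ENNReal.toReal_mul, ENNReal.toReal_ofReal hK.le]
  -- The positive region is cut out by a strict inequality and the negative one by a weak one, hence
  -- `Ioi 1` here and `Ici 1` below.
  obtain ⟨k1, g1, e1⟩ := key A (Ioi 1) hAm measurableSet_Ioi subset_rfl Ioi_subset_Ici_self hAcone
    (fun x hx => ⟨hx.1.ne', hx.2⟩)
  obtain ⟨k2, g2, e2⟩ := key A' (Ici 1) hAm' measurableSet_Ici Ioi_subset_Ici_self subset_rfl
    hAcone' (fun x hx => ⟨hx.1.ne, hx.2⟩)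
  have i1 := (integrable_indicator_iff (hAm.inter (hhm measurableSet_Ioi))).2 k1
  have i2 := (integrable_indicator_iff (hAm'.inter (hhm measurableSet_Ici))).2 k2
  have hae : (fun v => (A ∩ h ⁻¹' Ioi 1).indicator k v - (A' ∩ h ⁻¹' Ici 1).indicator k v) =ᵐ[volume]
      (fun v => (({v | 2 * |inner ℝ w v| < q v}.indicator (fun _ => (1 : ℝ)) v -
        {v | q v ≤ -(2 * |inner ℝ w v|)}.indicator (fun _ => (1 : ℝ)) v) * k v)) := by
    filter_upwards [ae_inner_ne_zero hw] with v hv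
    have hB : 0 < 2 * |inner ℝ w v| := mul_pos two_pos (abs_pos.2 hv)
    have m1 : v ∈ A ∩ h ⁻¹' Ioi 1 ↔ 2 * |inner ℝ w v| < q v := by
      simp only [hA, hh, mem_inter_iff, mem_ofPred_eq, mem_preimage, mem_Ioi, one_lt_div hB]
      constructor
      · rintro ⟨⟨h1, -⟩, h2⟩; rwa [abs_of_pos h1] at h2
      · intro h1
        have h2 := hB.trans h1
        exact ⟨⟨h2, hv⟩, by rwa [abs_of_pos h2]⟩
    have m2 : v ∈ A' ∩ h ⁻¹' Ici 1 ↔ q v ≤ -(2 * |inner ℝ w v|) := by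
      simp only [hA', hh, mem_inter_iff, mem_ofPred_eq, mem_preimage, mem_Ici, one_le_div hB]
      constructor
      · rintro ⟨⟨h1, -⟩, h2⟩; rw [abs_of_neg h1] at h2; linarith
      · intro h1
        have h2 : q v < 0 := by linarith
        exact ⟨⟨h2, hv⟩, by rw [abs_of_neg h2]; linarith⟩
    rw [sub_mul]
    congr 1
    · by_cases hm : 2 * |inner ℝ w v| < q v
      · rw [indicator_of_mem (m1.2 hm), indicator_of_mem (by exact hm), one_mul]
      · rw [indicator_of_notMem (mt m1.1 hm), indicator_of_notMem (by exact hm), zero_mul]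
    · by_cases hm : q v ≤ -(2 * |inner ℝ w v|)
      · rw [indicator_of_mem (m2.2 hm), indicator_of_mem (by exact hm), one_mul]
      · rw [indicator_of_notMem (mt m2.1 hm), indicator_of_notMem (by exact hm), zero_mul]
  refine ⟨K, hK, (i1.sub i2).congr hae, ?_⟩
  rw [← integral_congr_ae hae, integral_sub i1 i2,
    integral_indicator (hAm.inter (hhm measurableSet_Ioi)),
    integral_indicator (hAm'.inter (hhm measurableSet_Ici)), e1, e2, ← mul_sub,
    ← integral_indicator hAm, ← integral_indicator hAm', ← integral_sub
      ((integrable_indicator_iff hAm).2 g1) ((integrable_indicator_iff hAm').2 g2)]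
  congr 1
  refine integral_congr_ae ?_
  filter_upwards [ae_inner_ne_zero hw] with v hv
  rw [mul_assoc]
  change _ = Real.sign (q v) * g v
  rcases lt_trichotomy (q v) 0 with h1 | h1 | h1
  · have : v ∉ A := fun hm => h1.not_gt hm.1
    have h' : v ∈ A' := ⟨h1, hv⟩
    simp [this, h', Real.sign_of_neg h1]
  · have : v ∉ A := fun hm => hm.1.ne' h1
    have h' : v ∉ A' := fun hm => hm.1.ne h1
    simp [this, h', h1]
  · have : v ∉ A' := fun hm => h1.not_gt hm.1
    have h' : v ∈ A := ⟨h1, hv⟩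
    simp [this, h', Real.sign_of_pos h1]

/-! ### Reduction of the curvature of `C_α` to the moment -/

/-- Linear change of variables, up to a constant. -/
theorem exists_integral_comp_linearMap_eq {V : Type*} [NormedAddCommGroup V] [NormedSpace ℝ V]
    [FiniteDimensional ℝ V] [MeasurableSpace V] [BorelSpace V] (μ : Measure V) [μ.IsAddHaarMeasure]
    (T : V →ₗ[ℝ] V) (hT : Function.Injective T) :
    ∃ c : ℝ, 0 < c ∧ ∀ F : V → ℝ, Measurable F → (Integrable (fun x => F (T x)) μ ↔ Integrable F μ) ∧
      ∫ x, F (T x) ∂μ = c * ∫ x, F x ∂μ := by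
  have hdet : LinearMap.det T ≠ 0 := fun h =>
    (LinearMap.bot_lt_ker_of_det_eq_zero h).ne' (LinearMap.ker_eq_bot.2 hT)
  have hc : 0 < |(LinearMap.det T)⁻¹| := abs_pos.2 (inv_ne_zero hdet)
  have hmap := Measure.map_linearMap_addHaar_eq_smul_addHaar μ hdet
  have hTm : Measurable T := T.continuous_of_finiteDimensional.measurable
  refine ⟨_, hc, fun F hF => ⟨?_, ?_⟩⟩
  · have := integrable_map_measure (μ := μ) (g := F) hF.aestronglyMeasurable hTm.aemeasurable
    rw [hmap, integrable_smul_measure (ENNReal.ofReal_pos.2 hc).ne' ENNReal.ofReal_ne_top] at this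
    exact this.symm
  · have := integral_map (μ := μ) (f := F) hTm.aemeasurable hF.aestronglyMeasurable
    rw [hmap, integral_smul_measure, ENNReal.toReal_ofReal hc.le] at this
    exact this.symm

theorem Real.sign_mul_of_pos {c : ℝ} (hc : 0 < c) (t : ℝ) : Real.sign (c * t) = Real.sign t := by
  rcases lt_trichotomy t 0 with h | h | h
  · rw [Real.sign_of_neg h, Real.sign_of_neg (mul_neg_of_pos_of_neg hc h)]
  · simp [h]
  · rw [Real.sign_of_pos h, Real.sign_of_pos (mul_pos hc h)]

@[fun_prop]
theorem continuous_prodSpace_fst : Continuous fun x : ProdSpace m n => x.fst :=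
  (WithLp.prod_continuous_ofLp ..).fst

@[fun_prop]
theorem continuous_prodSpace_snd : Continuous fun x : ProdSpace m n => x.snd :=
  (WithLp.prod_continuous_ofLp ..).snd

@[fun_prop]
theorem measurable_prodSpace_fst : Measurable fun x : ProdSpace m n => x.fst :=
  continuous_prodSpace_fst.measurable

@[fun_prop]
theorem measurable_prodSpace_snd : Measurable fun x : ProdSpace m n => x.snd :=
  continuous_prodSpace_snd.measurable

noncomputable section

/-- The quadratic form `|z|² - α² |y|²`, which is positive exactly on `E_α`. -/
def coneForm (α : ℝ) (v : ProdSpace m n) : ℝ := ‖v.snd‖ ^ 2 - α ^ 2 * ‖v.fst‖ ^ 2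

/-- The linear map `(a, b) ↦ (λ a, μ b)`. -/
def diagonalMap (m n : ℕ) (l μ : ℝ) : ProdSpace m n →ₗ[ℝ] ProdSpace m n where
  toFun x := WithLp.toLp 2 (l • x.fst, μ • x.snd)
  map_add' x y := by
    apply WithLp.ofLp_injective
    simp
  map_smul' c x := by
    apply WithLp.ofLp_injective
    simp [smul_comm c]

end

theorem diagonalMap_fst (l μ : ℝ) (x : ProdSpace m n) : (diagonalMap m n l μ x).fst = l • x.fst :=
  rfl

theorem diagonalMap_snd (l μ : ℝ) (x : ProdSpace m n) : (diagonalMap m n l μ x).snd = μ • x.snd :=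
  rfl

theorem diagonalMap_injective {l μ : ℝ} (hl : l ≠ 0) (hμ : μ ≠ 0) :
    Function.Injective (diagonalMap m n l μ) := by
  intro x y h
  have h1 := congrArg WithLp.fst h
  have h2 := congrArg WithLp.snd h
  rw [diagonalMap_fst, diagonalMap_fst] at h1
  rw [diagonalMap_snd, diagonalMap_snd] at h2
  apply WithLp.ofLp_injective
  exact Prod.ext (smul_right_injective _ hl h1) (smul_right_injective _ hμ h2)

theorem measurable_coneForm (α : ℝ) : Measurable (coneForm α : ProdSpace m n → ℝ) := by
  unfold coneForm
  fun_prop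

theorem coneForm_diagonalMap (α l : ℝ) (x : ProdSpace m n) :
    coneForm α (diagonalMap m n l (l * α) x) = (l * α) ^ 2 * lightconeForm x := by
  simp only [coneForm, lightconeForm, diagonalMap_fst, diagonalMap_snd, norm_smul, mul_pow,
    Real.norm_eq_abs, sq_abs]
  ring

/-- The parameter `κ` for which `coneMoment ν s κ` has the sign of the curvature of `C_α`. -/
noncomputable def coneParam (α : ℝ) : ℝ := (α ^ 2 - 1) / (α ^ 2 + 1)

theorem abs_coneParam_lt_one {α : ℝ} (hα : 0 < α) : |coneParam α| < 1 := by
  rw [coneParam, abs_lt, lt_div_iff₀ (by positivity), div_lt_iff₀ (by positivity)]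
  have := pow_pos hα 2
  constructor <;> linarith

/-- The squared scaling factors are `l² = 1 - κ` and `l²α² = 1 + κ` for `κ = coneParam α`; the
normalization of `l` makes their mean equal to one. -/
theorem norm_diagonalMap_sq {α l : ℝ} (hl : l ^ 2 = 2 / (1 + α ^ 2)) (x : ProdSpace m n) :
    ‖diagonalMap m n l (l * α) x‖ ^ 2 = ‖x‖ ^ 2 + coneParam α * lightconeForm x := by
  simp only [norm_sq_eq_fst_add_snd, lightconeForm, diagonalMap_fst, diagonalMap_snd, norm_smul,
    mul_pow, Real.norm_eq_abs, sq_abs, hl, coneParam]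
  field_simp
  ring

/-- The nonlocal mean curvature of `C_α` exists and is a positive multiple of `coneMoment`. -/
theorem exists_hasNonlocalMeanCurvature_solidCone {s α : ℝ} (hs : s ∈ Ioc (0 : ℝ) (1 / 2))
    (hα : 0 < α) {p : ProdSpace m n} (hp : p ∈ lawsonCone m n α) (hp0 : p ≠ 0)
    {e : EuclideanSpace ℝ (Fin m)} {f : EuclideanSpace ℝ (Fin n)} (he : ‖e‖ = 1) (hf : ‖f‖ = 1) :
    ∃ c : ℝ, 0 < c ∧ HasNonlocalMeanCurvature s (solidCone m n α) p
      (c * coneMoment (lightconeNormal e f) s (coneParam α)) := by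
  have hp : ‖p.snd‖ = α * ‖p.fst‖ := hp
  set r := ‖p.fst‖ with hr
  have hr0 : 0 < r := by
    refine (norm_nonneg _).lt_of_ne fun h => hp0 ?_
    have h1 : p.fst = 0 := norm_eq_zero.1 h.symm
    have h2 : p.snd = 0 := by
      rw [← norm_eq_zero, hp, hr, ← h, mul_zero]
    exact WithLp.ofLp_injective 2 (Prod.ext h1 h2)
  -- Half the gradient of `coneForm α` at `p`; since the form vanishes at `p`, its value at `p + v`
  -- is `2⟪w, v⟫ + coneForm α v`.
  set w : ProdSpace m n := WithLp.toLp 2 (-(α ^ 2) • p.fst, p.snd) with hw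
  have hwin : ∀ v, inner ℝ w v = inner ℝ p.snd v.snd - α ^ 2 * inner ℝ p.fst v.fst := by
    intro v
    rw [WithLp.prod_inner_apply]
    simp [hw, inner_smul_left]
    ring
  have hw0 : w ≠ 0 := by
    intro h
    have : ‖p.snd‖ = 0 := by rw [show p.snd = 0 from congrArg WithLp.snd h, norm_zero]
    rw [hp] at this
    exact (mul_pos hα hr0).ne' this
  set f₀ : EuclideanSpace ℝ (Fin n) := (α * r)⁻¹ • p.snd with hf₀
  set e₀ : EuclideanSpace ℝ (Fin m) := r⁻¹ • p.fst with he₀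
  have hf₀1 : ‖f₀‖ = 1 := by
    rw [hf₀, norm_smul, hp, Real.norm_of_nonneg (by positivity), inv_mul_cancel₀ (by positivity)]
  have he₀1 : ‖e₀‖ = 1 := by
    rw [he₀, norm_smul, ← hr, Real.norm_of_nonneg (by positivity), inv_mul_cancel₀ (by positivity)]
  have hpf : p.snd = (α * r) • f₀ := by rw [hf₀, smul_inv_smul₀ (by positivity)]
  have hpe : p.fst = r • e₀ := by rw [he₀, smul_inv_smul₀ (by positivity)]
  rw [coneMoment_lightconeNormal_eq (he.trans he₀1.symm) (hf.trans hf₀1.symm)]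
  set ν := lightconeNormal e₀ f₀ with hν
  set l : ℝ := √(2 / (1 + α ^ 2)) with hl
  have hl0 : 0 < l := by positivity
  have hlsq : l ^ 2 = 2 / (1 + α ^ 2) := Real.sq_sqrt (by positivity)
  have hκ := abs_coneParam_lt_one hα
  obtain ⟨c, hc, hcF⟩ := exists_integral_comp_linearMap_eq (volume : Measure (ProdSpace m n))
    (diagonalMap m n l (l * α)) (diagonalMap_injective hl0.ne' (by positivity))
  set F : ProdSpace m n → ℝ := fun v => Real.sign (coneForm α v) *
    (|coneForm α v| / (2 * |inner ℝ w v|)) ^ s * Real.exp (-‖v‖ ^ 2) with hF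
  have hFm : Measurable F := by
    have h1 := measurable_sign.comp (measurable_coneForm (m := m) (n := n) α)
    have h2 := measurable_coneForm (m := m) (n := n) α
    simp only [Function.comp_def] at h1
    fun_prop
  -- The form pulls back to `(lα)² Q` and the functional to `lα² r ⟪ν, x⟫`, so `α` cancels from the
  -- quotient up to the factor `l / (2r)` and otherwise survives only in the Gaussian.
  have hFT : ∀ x, F (diagonalMap m n l (l * α) x) =
      (l / (2 * r)) ^ s * coneMomentIntegrand ν s (coneParam α) x := by
    intro x
    have hin : inner ℝ w (diagonalMap m n l (l * α) x) = l * α ^ 2 * r * inner ℝ ν x := by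
      rw [hwin, hν, inner_lightconeNormal, diagonalMap_fst, diagonalMap_snd, hpe, hpf]
      simp only [inner_smul_left, inner_smul_right]
      simp
      ring
    have hquot : |coneForm α (diagonalMap m n l (l * α) x)| /
        (2 * |inner ℝ w (diagonalMap m n l (l * α) x)|) =
        (l / (2 * r)) * (|lightconeForm x| / |inner ℝ ν x|) := by
      rw [coneForm_diagonalMap, hin, abs_mul, abs_mul, abs_of_pos (by positivity : 0 < (l * α) ^ 2),
        abs_of_pos (by positivity : 0 < l * α ^ 2 * r)]
      by_cases h : |inner ℝ ν x| = 0
      · rw [h]; simp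
      · field_simp
    simp only [hF, coneMomentIntegrand]
    rw [hquot, coneForm_diagonalMap, Real.sign_mul_of_pos (by positivity),
      Real.mul_rpow (by positivity) (by positivity), norm_diagonalMap_sq hlsq, neg_add']
    ring
  have hint : Integrable F := by
    rw [← (hcF F hFm).1]
    simp_rw [hFT]
    exact (integrable_coneMomentIntegrand (lightconeNormal_ne_zero hf₀1) ⟨hs.1.le, hs.2⟩
      hκ).const_mul _
  obtain ⟨K, hK, hKint, hKeq⟩ := exists_integral_kernel_eq_mul_integral_gaussian hs.1 hw0
    (measurable_coneForm α) (fun t v => by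
      simp only [coneForm, WithLp.smul_fst, WithLp.smul_snd, norm_smul, mul_pow, Real.norm_eq_abs,
        sq_abs]
      ring) hint
  have hval : ∫ v, F v = c⁻¹ * ((l / (2 * r)) ^ s * coneMoment ν s (coneParam α)) := by
    rw [coneMoment, ← integral_const_mul]
    simp_rw [← hFT]
    rw [(hcF F hFm).2, inv_mul_cancel_left₀ hc.ne']
  have hE : MeasurableSet (solidCone m n α) := by
    refine measurableSet_lt ?_ ?_ <;> fun_prop
  have hmem : ∀ v, p + v ∈ solidCone m n α ↔ 0 < 2 * inner ℝ w v + coneForm α v := by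
    intro v
    change α * ‖(p + v).fst‖ < ‖(p + v).snd‖ ↔ _
    rw [← sq_lt_sq₀ (by positivity) (norm_nonneg _), mul_pow, WithLp.add_fst, WithLp.add_snd,
      norm_add_sq_real, norm_add_sq_real, hp, ← hr, hwin, coneForm, ← sub_pos]
    ring_nf
  have hH := hasNonlocalMeanCurvature_of_quadratic hs.1 hE (fun v => by
      simp only [coneForm, WithLp.neg_fst, WithLp.neg_snd, norm_neg]) hmem hKint
  rw [hKeq, hval] at hH
  refine ⟨K * (c⁻¹ * (l / (2 * r)) ^ s), by positivity, ?_⟩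
  convert hH using 1
  ring

/-! ### The law of `|z| / |y|` and the moment at `s = 0` -/

theorem lintegral_fun_norm_eq {E : Type*} [NormedAddCommGroup E] [NormedSpace ℝ E]
    [MeasurableSpace E] [BorelSpace E] [FiniteDimensional ℝ E] [Nontrivial E] (μ : Measure E)
    [μ.IsAddHaarMeasure] {g : ℝ → ENNReal} (hg : Measurable g) :
    ∫⁻ x, g ‖x‖ ∂μ = μ.toSphere univ *
      ∫⁻ r in Ioi (0 : ℝ), ENNReal.ofReal (r ^ (Module.finrank ℝ E - 1)) * g r := by
  rw [lintegral_eq_lintegral_toSphere μ (by fun_prop), mul_comm, ← lintegral_const]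
  refine lintegral_congr fun ω => setLIntegral_congr_fun measurableSet_Ioi fun r hr => ?_
  have hω : ‖(ω : E)‖ = 1 := by simp
  rw [norm_smul, hω, mul_one, Real.norm_of_nonneg (le_of_lt hr)]

theorem setLIntegral_Ioi_eq_mul_setLIntegral_comp_mul {ρ : ℝ} (hρ : 0 < ρ) {g : ℝ → ENNReal}
    (hg : Measurable g) :
    ∫⁻ r in Ioi (0 : ℝ), g r = ENNReal.ofReal ρ * ∫⁻ t in Ioi (0 : ℝ), g (ρ * t) := by
  have h := Real.smul_map_volume_mul_left hρ.ne'
  have hpre : (fun t => ρ * t) ⁻¹' Ioi (0 : ℝ) = Ioi 0 := by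
    ext t; simp [hρ]
  conv_lhs => rw [← h]
  rw [Measure.restrict_smul, lintegral_smul_measure, abs_of_pos hρ,
    Measure.restrict_map (measurable_const_mul ρ) measurableSet_Ioi,
    lintegral_map hg (measurable_const_mul ρ), hpre, smul_eq_mul]

theorem coneDensity_nonneg {t : ℝ} (ht : 0 ≤ t) : 0 ≤ coneDensity m n t := by
  unfold coneDensity; positivity

theorem coneDensity_pos {t : ℝ} (ht : 0 < t) : 0 < coneDensity m n t := by
  unfold coneDensity; positivity

theorem measurable_coneDensity : Measurable (coneDensity m n) := by
  unfold coneDensity; fun_prop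

/-- The law of `|z| / |y|` under the Gaussian weight has density proportional to `coneDensity`. -/
theorem exists_lintegral_norm_ratio_eq (hm : 1 ≤ m) (hn : 1 ≤ n) :
    ∃ C : ℝ, 0 < C ∧ ∀ φ : ℝ → ENNReal, Measurable φ →
      ∫⁻ v : ProdSpace m n, φ (‖v.snd‖ / ‖v.fst‖) * ENNReal.ofReal (Real.exp (-‖v‖ ^ 2)) =
        ENNReal.ofReal C * ∫⁻ t in Ioi (0 : ℝ), φ t * ENNReal.ofReal (coneDensity m n t) := by
  have : Nonempty (Fin m) := ⟨⟨0, hm⟩⟩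
  have : Nonempty (Fin n) := ⟨⟨0, hn⟩⟩
  have hN : (0 : ℝ) < ((m : ℝ) + n) / 2 := by
    have : (1 : ℝ) ≤ m := by exact_mod_cast hm
    positivity
  set σm := (volume : Measure (EuclideanSpace ℝ (Fin m))).toSphere univ with hσm
  set σn := (volume : Measure (EuclideanSpace ℝ (Fin n))).toSphere univ with hσn
  have hσm0 : σm ≠ 0 := Measure.measure_univ_ne_zero.2 (Measure.toSphere_ne_zero _)
  have hσn0 : σn ≠ 0 := Measure.measure_univ_ne_zero.2 (Measure.toSphere_ne_zero _)
  have hσmt : σm ≠ ⊤ := measure_ne_top _ _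
  have hσnt : σn ≠ ⊤ := measure_ne_top _ _
  set G : ℝ := 1 / 2 * Real.Gamma (((m : ℝ) + n) / 2) with hG
  have hG0 : 0 < G := mul_pos (by norm_num) (Real.Gamma_pos_of_pos hN)
  refine ⟨σm.toReal * σn.toReal * G, mul_pos (mul_pos (ENNReal.toReal_pos hσm0 hσmt)
    (ENNReal.toReal_pos hσn0 hσnt)) hG0, fun φ hφ => ?_⟩
  have h1 : ∫⁻ v : ProdSpace m n, φ (‖v.snd‖ / ‖v.fst‖) * ENNReal.ofReal (Real.exp (-‖v‖ ^ 2)) =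
      ∫⁻ y : EuclideanSpace ℝ (Fin m), ∫⁻ z : EuclideanSpace ℝ (Fin n),
        φ (‖z‖ / ‖y‖) * ENNReal.ofReal (Real.exp (-(‖y‖ ^ 2 + ‖z‖ ^ 2))) := by
    rw [← lintegral_prod (μ := volume) (ν := volume)
      (fun p : EuclideanSpace ℝ (Fin m) × EuclideanSpace ℝ (Fin n) =>
      φ (‖p.2‖ / ‖p.1‖) * ENNReal.ofReal (Real.exp (-(‖p.1‖ ^ 2 + ‖p.2‖ ^ 2))))
      (Measurable.aemeasurable (by fun_prop))]
    rw [← Measure.volume_eq_prod, ← (WithLp.volume_preserving_ofLp (EuclideanSpace ℝ (Fin m))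
      (EuclideanSpace ℝ (Fin n))).lintegral_comp (by fun_prop)]
    refine lintegral_congr fun v => ?_
    rw [norm_sq_eq_fst_add_snd]
    rfl
  have h2 : ∀ y : EuclideanSpace ℝ (Fin m), ∫⁻ z : EuclideanSpace ℝ (Fin n),
        φ (‖z‖ / ‖y‖) * ENNReal.ofReal (Real.exp (-(‖y‖ ^ 2 + ‖z‖ ^ 2))) =
      σn * ∫⁻ r in Ioi (0 : ℝ), ENNReal.ofReal (r ^ (n - 1)) *
        (φ (r / ‖y‖) * ENNReal.ofReal (Real.exp (-(‖y‖ ^ 2 + r ^ 2)))) := by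
    intro y
    have := lintegral_fun_norm_eq (volume : Measure (EuclideanSpace ℝ (Fin n)))
      (g := fun r => φ (r / ‖y‖) * ENNReal.ofReal (Real.exp (-(‖y‖ ^ 2 + r ^ 2)))) (by fun_prop)
    rwa [finrank_euclideanSpace_fin] at this
  have hmeas : Measurable fun ρ : ℝ => ∫⁻ r in Ioi (0 : ℝ), ENNReal.ofReal (r ^ (n - 1)) *
        (φ (r / ρ) * ENNReal.ofReal (Real.exp (-(ρ ^ 2 + r ^ 2)))) :=
    Measurable.lintegral_prod_right' (f := fun p : ℝ × ℝ => ENNReal.ofReal (p.2 ^ (n - 1)) *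
        (φ (p.2 / p.1) * ENNReal.ofReal (Real.exp (-(p.1 ^ 2 + p.2 ^ 2))))) (by fun_prop)
  have h3 := lintegral_fun_norm_eq (volume : Measure (EuclideanSpace ℝ (Fin m))) hmeas
  rw [finrank_euclideanSpace_fin] at h3
  simp_rw [h1, h2]
  rw [lintegral_const_mul _ (by fun_prop), h3, ← hσm]
  -- Substitution `r = ρt`: the Jacobian `ρ` joins `ρ^(m-1)` and `ρ^(n-1)` to give `ρ^(N-1)`.
  have h4 : ∀ ρ ∈ Ioi (0 : ℝ), ENNReal.ofReal (ρ ^ (m - 1)) *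
      ∫⁻ r in Ioi (0 : ℝ), ENNReal.ofReal (r ^ (n - 1)) *
        (φ (r / ρ) * ENNReal.ofReal (Real.exp (-(ρ ^ 2 + r ^ 2)))) =
      ∫⁻ t in Ioi (0 : ℝ), φ t * ENNReal.ofReal (t ^ (n - 1) *
        (ρ ^ ((m : ℝ) + n - 1) * Real.exp (-(1 + t ^ 2) * ρ ^ (2 : ℝ)))) := by
    intro ρ hρ
    have hρ : 0 < ρ := hρ
    rw [setLIntegral_Ioi_eq_mul_setLIntegral_comp_mul hρ (by fun_prop), ← mul_assoc,
      ← lintegral_const_mul _ (by fun_prop)]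
    refine setLIntegral_congr_fun measurableSet_Ioi fun t ht => ?_
    have ht : 0 < t := ht
    rw [mul_div_cancel_left₀ _ hρ.ne', mul_comm (φ t), ← mul_assoc, mul_comm _ (φ t), mul_comm (φ t),
      ← mul_assoc, mul_comm _ (φ t), ← ENNReal.ofReal_mul (by positivity),
      ← ENNReal.ofReal_mul (by positivity), ← ENNReal.ofReal_mul (by positivity)]
    congr 2
    have e1 : ρ ^ ((m : ℝ) + n - 1) = ρ ^ (m - 1) * ρ * ρ ^ (n - 1) := by
      rw [← pow_succ, Nat.sub_add_cancel hm, ← pow_add, ← Real.rpow_natCast]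
      congr 1
      rw [Nat.cast_add, Nat.cast_sub hn]
      push_cast; ring
    rw [e1, Real.rpow_two, mul_pow, show -(ρ ^ 2 + (ρ * t) ^ 2) = -(1 + t ^ 2) * ρ ^ 2 by ring]
    ring
  rw [setLIntegral_congr_fun measurableSet_Ioi h4, lintegral_lintegral_swap
    (Measurable.aemeasurable (by fun_prop))]
  -- The integral in `ρ` is a Gamma integral, equal to `G * (1 + t²)^(-N/2)`.
  have h5 : ∀ t ∈ Ioi (0 : ℝ), ∫⁻ ρ in Ioi (0 : ℝ), φ t * ENNReal.ofReal (t ^ (n - 1) *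
        (ρ ^ ((m : ℝ) + n - 1) * Real.exp (-(1 + t ^ 2) * ρ ^ (2 : ℝ)))) =
      ENNReal.ofReal G * (φ t * ENNReal.ofReal (coneDensity m n t)) := by
    intro t ht
    have ht : 0 < t := ht
    have hq : (-1 : ℝ) < (m : ℝ) + n - 1 := by linarith
    have hint := integrableOn_rpow_mul_exp_neg_mul_rpow hq two_pos
      (b := 1 + t ^ 2) (by positivity)
    have hval := integral_rpow_mul_exp_neg_mul_rpow (p := 2) two_pos hq
      (b := 1 + t ^ 2) (by positivity)
    rw [lintegral_const_mul _ (by fun_prop), ← ofReal_integral_eq_lintegral_ofReal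
      (hint.const_mul _) (by
        filter_upwards [ae_restrict_mem measurableSet_Ioi] with ρ hρ
        have : (0 : ℝ) < ρ := hρ
        simp only [Pi.zero_apply]; positivity), integral_const_mul, hval,
      mul_left_comm (ENNReal.ofReal G), ← ENNReal.ofReal_mul hG0.le]
    congr 2
    rw [coneDensity, sub_add_cancel, neg_div, Real.rpow_neg (by positivity), hG]
    field_simp
  rw [setLIntegral_congr_fun measurableSet_Ioi h5, lintegral_const_mul _ (by
      have := measurable_coneDensity (m := m) (n := n)
      fun_prop), ENNReal.ofReal_mul (p := σm.toReal * σn.toReal) (by positivity),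
    ENNReal.ofReal_mul (p := σm.toReal) (by positivity),
    ENNReal.ofReal_toReal hσmt, ENNReal.ofReal_toReal hσnt]
  ring

/-- With test function `1` in the law of `|z| / |y|`, the total mass of the density is a multiple of
the finite Gaussian mass. -/
theorem integrableOn_coneDensity (hm : 1 ≤ m) (hn : 1 ≤ n) :
    IntegrableOn (coneDensity m n) (Ioi 0) := by
  obtain ⟨C, hC, h⟩ := exists_lintegral_norm_ratio_eq hm hn
  have h1 := h 1 measurable_one
  simp only [Pi.one_apply, one_mul] at h1
  have h2 : Integrable (fun v : ProdSpace m n => Real.exp (-‖v‖ ^ 2)) := by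
    simpa using integrable_exp_neg_mul_norm_sq (V := ProdSpace m n) one_pos
  have h3 := h2.lintegral_lt_top
  rw [h1] at h3
  refine ⟨measurable_coneDensity.aestronglyMeasurable, ?_⟩
  rw [hasFiniteIntegral_iff_ofReal (by
    filter_upwards [ae_restrict_mem measurableSet_Ioi] with t ht
    exact coneDensity_nonneg (le_of_lt ht))]
  refine lt_of_le_of_ne le_top fun htop => ?_
  rw [htop, ENNReal.mul_top (ENNReal.ofReal_pos.2 hC).ne'] at h3
  exact lt_irrefl _ h3

theorem ae_prodSpace_fst_ne_zero (hm : 1 ≤ m) : ∀ᵐ v : ProdSpace m n, v.fst ≠ 0 := by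
  have : Nonempty (Fin m) := ⟨⟨0, hm⟩⟩
  obtain ⟨e, he⟩ := exists_ne (0 : EuclideanSpace ℝ (Fin m))
  have hw : (WithLp.toLp 2 (e, 0) : ProdSpace m n) ≠ 0 := fun h => he (congrArg WithLp.fst h)
  filter_upwards [ae_inner_ne_zero hw] with v hv h0
  refine hv ?_
  rw [WithLp.prod_inner_apply]
  simp [h0]

/-- At `s = 0` the moment is a positive multiple of the difference of the two masses. -/
theorem exists_coneMoment_zero_eq (hm : 1 ≤ m) (hn : 1 ≤ n) (ν : ProdSpace m n) {α : ℝ}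
    (hα : 0 < α) :
    ∃ c : ℝ, 0 < c ∧ coneMoment ν 0 (coneParam α) =
      c * ((∫ t in Ioi α, coneDensity m n t) - ∫ t in (0 : ℝ)..α, coneDensity m n t) := by
  obtain ⟨C, hC, h⟩ := exists_lintegral_norm_ratio_eq hm hn
  set l : ℝ := √(2 / (1 + α ^ 2)) with hl
  have hl0 : 0 < l := by positivity
  have hlsq : l ^ 2 = 2 / (1 + α ^ 2) := Real.sq_sqrt (by positivity)
  obtain ⟨c, hc, hcF⟩ := exists_integral_comp_linearMap_eq (volume : Measure (ProdSpace m n))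
    (diagonalMap m n l (l * α)) (diagonalMap_injective hl0.ne' (by positivity))
  set g : ProdSpace m n → ℝ := fun v => Real.exp (-‖v‖ ^ 2) with hg
  have hgi : Integrable g := by
    simpa using integrable_exp_neg_mul_norm_sq (V := ProdSpace m n) one_pos
  have hgm : Measurable g := by fun_prop
  have hmass : ∀ S : Set ℝ, MeasurableSet S →
      ∫ v, ((fun v : ProdSpace m n => ‖v.snd‖ / ‖v.fst‖) ⁻¹' S).indicator g v =
        C * ∫ t in S ∩ Ioi 0, coneDensity m n t := by
    intro S hS
    have hpre : MeasurableSet ((fun v : ProdSpace m n => ‖v.snd‖ / ‖v.fst‖) ⁻¹' S) :=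
      (show Measurable (fun v : ProdSpace m n => ‖v.snd‖ / ‖v.fst‖) by fun_prop) hS
    have hS' := h (S.indicator 1) (measurable_one.indicator hS)
    rw [integral_indicator hpre, integral_eq_lintegral_of_nonneg_ae
        (Eventually.of_forall fun v => (Real.exp_pos _).le) hgm.aestronglyMeasurable,
      integral_eq_lintegral_of_nonneg_ae (by
        filter_upwards [ae_restrict_mem (hS.inter measurableSet_Ioi)] with t ht
        exact coneDensity_nonneg (le_of_lt ht.2)) measurable_coneDensity.aestronglyMeasurable,
      ← congrArg (· * _) (ENNReal.toReal_ofReal hC.le)]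
    refine Eq.trans ?_ ENNReal.toReal_mul
    congr 1
    rw [← lintegral_indicator hpre, ← Measure.restrict_restrict hS, ← lintegral_indicator hS]
    refine Eq.trans (lintegral_congr fun v => ?_) (hS'.trans (congrArg _ (lintegral_congr fun t => ?_)))
    · by_cases hv : ‖v.snd‖ / ‖v.fst‖ ∈ S
      · rw [indicator_of_mem (by exact hv), indicator_of_mem hv, Pi.one_apply, one_mul]
      · rw [indicator_of_notMem (by exact hv), indicator_of_notMem hv, zero_mul]
    · by_cases ht : t ∈ S <;> simp [ht]
  have hF : coneMoment ν 0 (coneParam α) = c * ∫ v, Real.sign (coneForm α v) * g v := by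
    rw [← (hcF (fun v => Real.sign (coneForm α v) * g v)
      ((measurable_sign.comp (measurable_coneForm α)).mul hgm)).2, coneMoment]
    refine integral_congr_ae (Eventually.of_forall fun x => ?_)
    simp only [coneMomentIntegrand, Real.rpow_zero, mul_one, hg]
    rw [norm_diagonalMap_sq hlsq, coneForm_diagonalMap, Real.sign_mul_of_pos (by positivity),
      neg_add']
  -- Where `y ≠ 0`, the form factors with a positive factor `|z| + α|y|`, so its sign is that of
  -- `|z|/|y| - α`.
  have hsplit : ∫ v, Real.sign (coneForm α v) * g v =
      (∫ v, ((fun v : ProdSpace m n => ‖v.snd‖ / ‖v.fst‖) ⁻¹' Ioi α).indicator g v) -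
      ∫ v, ((fun v : ProdSpace m n => ‖v.snd‖ / ‖v.fst‖) ⁻¹' Iio α).indicator g v := by
    have hr : Measurable (fun v : ProdSpace m n => ‖v.snd‖ / ‖v.fst‖) := by fun_prop
    rw [← integral_sub (hgi.indicator (hr measurableSet_Ioi))
      (hgi.indicator (hr measurableSet_Iio))]
    refine integral_congr_ae ?_
    filter_upwards [ae_prodSpace_fst_ne_zero hm] with v hv
    have hv0 : 0 < ‖v.fst‖ := norm_pos_iff.2 hv
    have hq : coneForm α v = (‖v.snd‖ - α * ‖v.fst‖) * (‖v.snd‖ + α * ‖v.fst‖) := by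
      rw [coneForm]; ring
    have hpos : 0 < ‖v.snd‖ + α * ‖v.fst‖ := by positivity
    rw [hq, mul_comm (‖v.snd‖ - α * ‖v.fst‖), Real.sign_mul_of_pos hpos]
    rcases lt_trichotomy (‖v.snd‖ / ‖v.fst‖) α with h1 | h1 | h1
    · rw [indicator_of_notMem (by exact h1.not_gt), indicator_of_mem (by exact h1),
        Real.sign_of_neg (by rw [div_lt_iff₀ hv0] at h1; linarith)]
      ring
    · rw [indicator_of_notMem (by exact h1.not_gt), indicator_of_notMem (by exact h1.not_lt)]
      rw [div_eq_iff hv0.ne'] at h1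
      simp [h1]
    · rw [indicator_of_mem (by exact h1), indicator_of_notMem (by exact h1.not_gt),
        Real.sign_of_pos (by rw [lt_div_iff₀ hv0] at h1; linarith)]
      ring
  refine ⟨c * C, by positivity, ?_⟩
  rw [hF, hsplit, hmass _ measurableSet_Ioi, hmass _ measurableSet_Iio,
    intervalIntegral.integral_of_le hα.le, integral_Ioc_eq_integral_Ioo,
    inter_comm (Iio α), Ioi_inter_Iio, Ioi_inter_Ioi, sup_of_le_left hα.le]
  ring

/-! ### Minimal cones as zeros of the moment, and their limit -/

theorem coneParam_strictMonoOn : StrictMonoOn coneParam (Ioi 0) := by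
  intro a ha b hb hab
  have ha : 0 < a := ha
  have hb : 0 < b := hb
  rw [coneParam, coneParam, div_lt_div_iff₀ (by positivity) (by positivity)]
  have : a ^ 2 < b ^ 2 := by gcongr
  linarith

theorem continuous_coneParam : Continuous coneParam := by
  unfold coneParam
  exact Continuous.div (by fun_prop) (by fun_prop) fun x => by positivity

/-- A cone is `s`-minimal exactly when its moment vanishes. -/
theorem isNonlocalMinimalCone_iff {s α : ℝ} (hs : s ∈ Ioc (0 : ℝ) (1 / 2))
    {e : EuclideanSpace ℝ (Fin m)} {f : EuclideanSpace ℝ (Fin n)} (he : ‖e‖ = 1) (hf : ‖f‖ = 1) :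
    IsNonlocalMinimalCone m n s α ↔
      0 < α ∧ coneMoment (lightconeNormal e f) s (coneParam α) = 0 := by
  refine and_congr_right fun hα => ⟨fun h => ?_, fun h p hp hp0 => ?_⟩
  -- One point suffices here: the curvature at every nonzero point of the cone is a positive
  -- multiple of the same moment.
  · have hp : (WithLp.toLp 2 (e, α • f) : ProdSpace m n) ∈ lawsonCone m n α := by
      simp [lawsonCone, norm_smul, he, hf, abs_of_pos hα]
    have hp0 : (WithLp.toLp 2 (e, α • f) : ProdSpace m n) ≠ 0 := by
      intro h0
      have : e = 0 := congrArg WithLp.fst h0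
      simp [this] at he
    obtain ⟨c, hc, hcH⟩ := exists_hasNonlocalMeanCurvature_solidCone hs hα hp hp0 he hf
    have := tendsto_nhds_unique hcH.2 (h _ hp hp0).2
    exact (mul_eq_zero.1 this).resolve_left hc.ne'
  · obtain ⟨c, hc, hcH⟩ := exists_hasNonlocalMeanCurvature_solidCone hs hα hp hp0 he hf
    rwa [h, mul_zero] at hcH

/-- The two masses of `coneDensity` on both sides of a point balance somewhere. -/
theorem exists_coneDensity_balance (hm : 1 ≤ m) (hn : 1 ≤ n) :
    ∃ α₀ : ℝ, 0 < α₀ ∧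
      (∫ t in Ioi α₀, coneDensity m n t) - (∫ t in (0 : ℝ)..α₀, coneDensity m n t) = 0 := by
  have hint := integrableOn_coneDensity hm hn
  have hint' : ∀ a b : ℝ, 0 ≤ a → 0 ≤ b → IntervalIntegrable (coneDensity m n) volume a b :=
    fun a b ha hb => ⟨hint.mono_set fun t ht => ha.trans_lt ht.1,
      hint.mono_set fun t ht => hb.trans_lt ht.1⟩
  set I := ∫ t in Ioi (0 : ℝ), coneDensity m n t with hI
  have hI0 : 0 < I := by
    refine (setIntegral_pos_iff_support_of_nonneg_ae ?_ hint).2 ?_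
    · filter_upwards [ae_restrict_mem measurableSet_Ioi] with t ht
      exact coneDensity_nonneg (le_of_lt ht)
    · refine lt_of_lt_of_le (b := volume (Ioi (0 : ℝ))) (by simp) (measure_mono fun t ht => ?_)
      exact ⟨(coneDensity_pos ht).ne', ht⟩
  have hlim := intervalIntegral_tendsto_integral_Ioi 0 hint tendsto_id
  obtain ⟨A, hA, hA0⟩ := ((hlim.eventually (lt_mem_nhds (half_lt_self hI0))).and
    (eventually_gt_atTop 0)).exists
  have hcont : ContinuousOn (fun x => ∫ t in (0 : ℝ)..x, coneDensity m n t) (Icc 0 A) := by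
    have := intervalIntegral.continuousOn_primitive_interval' (hint' 0 A le_rfl hA0.le)
      left_mem_uIcc
    rwa [uIcc_of_le hA0.le] at this
  -- The balance point is the median: the primitive runs from `0` to above half the total mass `I`,
  -- so it attains `I / 2`.
  obtain ⟨α₀, hα₀, hα₀eq⟩ := intermediate_value_Icc hA0.le hcont
    (show I / 2 ∈ _ from ⟨by simpa using (half_pos hI0).le, hA.le⟩)
  have hpos : 0 < α₀ := by
    refine hα₀.1.lt_of_ne fun h => ?_
    rw [← h] at hα₀eq
    simp at hα₀eq
    linarith
  refine ⟨α₀, hpos, ?_⟩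
  have hadd := intervalIntegral.integral_interval_add_Ioi hint
    (hint.mono_set (Ioi_subset_Ioi hpos.le))
  simp only at hα₀eq
  linarith

theorem mainTheorem7 (m n : ℕ) (hn : 1 ≤ n) (hnm : n ≤ m) :
    IntegrableOn (coneDensity m n) (Ioi 0) volume ∧
    (∀ᶠ s in 𝓝[>] (0 : ℝ), ∃ α : ℝ, IsNonlocalMinimalCone m n s α) ∧
    ∃ α₀ : ℝ, 0 < α₀ ∧
      (∀ α : ℝ → ℝ, (∀ᶠ s in 𝓝[>] (0 : ℝ), IsNonlocalMinimalCone m n s (α s)) →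
        Tendsto α (𝓝[>] 0) (𝓝 α₀)) ∧
      (∫ t in Ioi α₀, coneDensity m n t) - (∫ t in (0 : ℝ)..α₀, coneDensity m n t) = 0 ∧
      ∀ β : ℝ, 0 < β →
        (∫ t in Ioi β, coneDensity m n t) - (∫ t in (0 : ℝ)..β, coneDensity m n t) = 0 →
        β = α₀ := by
  have hm : 1 ≤ m := hn.trans hnm
  have : Nonempty (Fin m) := ⟨⟨0, hm⟩⟩
  have : Nonempty (Fin n) := ⟨⟨0, hn⟩⟩
  obtain ⟨e, he⟩ := exists_norm_eq (EuclideanSpace ℝ (Fin m)) zero_le_one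
  obtain ⟨f, hf⟩ := exists_norm_eq (EuclideanSpace ℝ (Fin n)) zero_le_one
  set ν := lightconeNormal e f with hν
  have hν0 : ν ≠ 0 := lightconeNormal_ne_zero hf
  obtain ⟨α₀, hα₀, hbal⟩ := exists_coneDensity_balance hm hn
  have hanti : ∀ s ∈ Icc (0 : ℝ) (1 / 2),
      StrictAntiOn (fun α => coneMoment ν s (coneParam α)) (Ioi 0) := fun s hs =>
    (coneMoment_strictAntiOn hν0 (exists_lightconeForm_ne_zero hf) hs).comp_strictMonoOn
      coneParam_strictMonoOn fun α hα => abs_lt.1 (abs_coneParam_lt_one hα)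
  have h0 : (0 : ℝ) ∈ Icc (0 : ℝ) (1 / 2) := by norm_num
  have hzero : ∀ β : ℝ, 0 < β →
      (∫ t in Ioi β, coneDensity m n t) - (∫ t in (0 : ℝ)..β, coneDensity m n t) = 0 →
      coneMoment ν 0 (coneParam β) = 0 := by
    intro β hβ h
    obtain ⟨c, -, hc⟩ := exists_coneMoment_zero_eq hm hn ν hβ
    rw [hc, h, mul_zero]
  have hsmall : ∀ᶠ s in 𝓝[>] (0 : ℝ), s ∈ Ioc (0 : ℝ) (1 / 2) :=
    Ioc_mem_nhdsGT (by norm_num)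
  -- The `s = 0` moment vanishes at `α₀` and strictly decreases, so it is positive at `a`;
  -- convergence at this single point keeps the sign for small `s`.
  have hlow : ∀ a : ℝ, 0 < a → a < α₀ →
      ∀ᶠ s in 𝓝[>] (0 : ℝ), 0 < coneMoment ν s (coneParam a) := fun a ha haα => by
    have := hanti 0 h0 ha hα₀ haα
    simp only [hzero α₀ hα₀ hbal] at this
    exact (tendsto_coneMoment_zero hν0 (abs_coneParam_lt_one ha)).eventually (lt_mem_nhds this)
  have hhigh : ∀ b : ℝ, α₀ < b →
      ∀ᶠ s in 𝓝[>] (0 : ℝ), coneMoment ν s (coneParam b) < 0 := fun b hb => by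
    have hb0 := hα₀.trans hb
    have := hanti 0 h0 hα₀ hb0 hb
    simp only [hzero α₀ hα₀ hbal] at this
    exact (tendsto_coneMoment_zero hν0 (abs_coneParam_lt_one hb0)).eventually (gt_mem_nhds this)
  refine ⟨integrableOn_coneDensity hm hn, ?_, α₀, hα₀, ?_, hbal, ?_⟩
  · filter_upwards [hsmall, hlow (α₀ / 2) (by positivity) (by linarith),
      hhigh (2 * α₀) (by linarith)] with s hs h1 h2
    have hle : α₀ / 2 ≤ 2 * α₀ := by linarith
    have hκ2 := abs_coneParam_lt_one (α := 2 * α₀) (by positivity)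
    have hκ1 := abs_coneParam_lt_one (α := α₀ / 2) (by positivity)
    have hcont : ContinuousOn (fun α => coneMoment ν s (coneParam α)) (Icc (α₀ / 2) (2 * α₀)) := by
      -- On a compact interval of `α > 0` the parameter stays within `[-k, k]` for some `k < 1`; by
      -- monotonicity the larger endpoint modulus serves as `k`.
      refine (continuousOn_coneMoment hν0 ⟨hs.1.le, hs.2⟩ (max_lt hκ1 hκ2)).comp
        continuous_coneParam.continuousOn fun α hα => ?_
      have hpos : 0 < α := lt_of_lt_of_le (by positivity) hα.1
      have hlo := coneParam_strictMonoOn.monotoneOn (show α₀ / 2 ∈ Ioi 0 by simpa using hα₀)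
        (show α ∈ Ioi 0 from hpos) hα.1
      have hhi := coneParam_strictMonoOn.monotoneOn (show α ∈ Ioi 0 from hpos)
        (show 2 * α₀ ∈ Ioi 0 by simpa using hα₀) hα.2
      exact ⟨by linarith [neg_abs_le (coneParam (α₀ / 2)),
          le_max_left |coneParam (α₀ / 2)| |coneParam (2 * α₀)|],
        by linarith [le_abs_self (coneParam (2 * α₀)),
          le_max_right |coneParam (α₀ / 2)| |coneParam (2 * α₀)|]⟩
    obtain ⟨α, hα, hαeq⟩ := intermediate_value_Icc' hle hcont
      (show (0 : ℝ) ∈ _ from ⟨h2.le, h1.le⟩)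
    exact ⟨α, (isNonlocalMinimalCone_iff hs he hf).2
      ⟨lt_of_lt_of_le (by positivity) hα.1, hαeq⟩⟩
  · intro α hα
    refine tendsto_order.2 ⟨fun a ha => ?_, fun b hb => ?_⟩
    -- The lower bound `a` may be nonpositive, whereas the monotonicity holds only for `α > 0`;
    -- hence the maximum with `α₀ / 2`.
    · filter_upwards [hsmall, hα, hlow (max a (α₀ / 2)) (lt_max_of_lt_right (by positivity))
        (max_lt ha (by linarith))] with s hs hmin h1
      obtain ⟨hpos, hz⟩ := (isNonlocalMinimalCone_iff hs he hf).1 hmin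
      have hmax : 0 < max a (α₀ / 2) := lt_max_of_lt_right (half_pos hα₀)
      have : max a (α₀ / 2) < α s :=
        ((hanti s ⟨hs.1.le, hs.2⟩).lt_iff_gt hpos hmax).1
          (hz.trans_lt h1)
      exact (le_max_left _ _).trans_lt this
    · filter_upwards [hsmall, hα, hhigh b hb] with s hs hmin h1
      obtain ⟨hpos, hz⟩ := (isNonlocalMinimalCone_iff hs he hf).1 hmin
      exact ((hanti s ⟨hs.1.le, hs.2⟩).lt_iff_gt (hα₀.trans hb) hpos).1
          (h1.trans_eq hz.symm)
  · intro β hβ h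
    refine (hanti 0 h0).injOn hβ hα₀ ?_
    simp only [hzero α₀ hα₀ hbal, hzero β hβ h]
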